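/- \textbf{Conventions.} A \emph{polytope} is the convex hull of a nonempty finite subset of a real vector space $\mathbb{R}^m$; its \emph{dimension} is that of its affine hull, and a \emph{$d$-polytope} is a polytope of dimension $d$. The \emph{faces} of a polytope $P$ are $\emptyset$ and the sets of maximizers over $P$ of linear functionals (so $P$ is a face of $P$); the empty face has dimension $-1$. The \emph{$k$-skeleton} of $P$ is the complex of all faces of $P$ of dimension at most $k$; two polytopes, or two skeleta, are \emph{combinatorially equivalent} if their posets of faces, ordered by inclusion, are isomorphic. A \emph{combinatorial $n$-cube} is a polytope combinatorially equivalent to $[0,1]^n$. A polytope is \emph{cubical} if each of its nonempty proper faces is a combinatorial $k$-cube for some $k$. For $n\ge d\ge 2$, a \emph{neighborly cubical $d$-polytope} with $2^n$ vertices is a cubical $d$-polytope with $2^n$ vertices whose $(\lfloor d/2\rfloor-1)$-skeleton is combinatorially equivalent to that of $[0,1]^n$. The $k$-skeleton of a polytope $P$ is \emph{dimensionally ambiguous} if there is a polytope $Q$ with $\dim Q\neq\dim P$ whose $k$-skeleton is combinatorially equivalent to that of $P$. The \emph{graph} of a polytope is its $1$-skeleton. For $0<\varepsilon\le 1$ let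 $C^n(\varepsilon)\subseteq\mathbb{R}^n$ be the set of all $x\in\mathbb{R}^n$ with $$\varepsilon|x_k|\ \le\ \frac{2^{\binom k2}}{\varepsilon^{k-1}}-(-1)^k\sum_{j=1}^{k-1}\binom{k-2}{j-1}x_j\qquad\text{for } 1\le k\le n .$$ \textbf{Theorem.} (1) Let $n\ge d\ge 2r+2$ with $r\ge 0$, and let $\pi:\mathbb{R}^n\to\mathbb{R}^d$, $(x_1,\dots,x_n)\mapsto(x_{n-d+1},\dots,x_n)$, be the projection to the last $d$ coordinates. For every $0<\varepsilon\le1$, the set $C^n(\varepsilon)$ is a combinatorial $n$-cube. Moreover there is an $\varepsilon_0\in(0,1]$ such that for every $0<\varepsilon<\varepsilon_0$ the image $C_d^n:=\pi(C^n(\varepsilon))$ is a cubical $d$-polytope, and $\pi$ restricts to an isomorphism from the $r$-skeleton of $C^n(\varepsilon)$ to the $r$-skeleton of $C_d^n$: the map $F\mapsto\pi(F)$ is an inclusion-preserving bijection, with inclusion-preserving inverse, from the faces of $C^n(\varepsilon)$ of dimension at most $r$ to the faces of $C_d^n$ of dimension at most $r$, and $\pi$ is injective on the union of the faces of $C^n(\varepsilon)$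 of dimension at most $r$. (2) For all $n\ge d\ge2$ there is a neighborly cubical $d$-polytope in $\mathbb{R}^d$ with $2^n$ vertices. (3) For every $n\ge5$, the graph of the $n$-cube $[0,1]^n$ is dimensionally ambiguous. -/

import Mathlib

namespace CubicalPolytopes

section Polytopes

variable {E : Type*} [NormedAddCommGroup E] [NormedSpace ℝ E]

/-- A (nonempty) convex polytope: the convex hull of a nonempty finite set of points. -/
def IsPolytope (P : Set E) : Prop :=
  ∃ s : Finset E, s.Nonempty ∧ P = convexHull ℝ (s : Set E)

/-- The dimension of the affine hull of `P` (the value at `∅` is `0`). -/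
noncomputable def dimension (P : Set E) : ℕ :=
  Module.finrank ℝ (vectorSpan ℝ P)

/-- The face poset of `P`, ordered by inclusion. A face is the set of maximizers over `P` of a
linear functional, or the empty set; in particular `∅` and `P` itself are faces. -/
abbrev Face (P : Set E) : Type _ :=
  {F : Set E // IsExposed ℝ P F}

/-- The `k`-skeleton of `P`: the poset, ordered by inclusion, of all faces of dimension at most `k`
(the empty face included). -/
abbrev Skeleton (k : ℕ) (P : Set E) : Type _ :=
  {F : Set E // IsExposed ℝ P F ∧ dimension F ≤ k}

/-- The vertices of `P`. -/
def vertices (P : Set E) : Set E :=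
  {v | IsExposed ℝ P {v}}

/-- The standard `n`-cube `[0,1]^n`. -/
def standardCube (n : ℕ) : Set (Fin n → ℝ) :=
  {x | ∀ i, 0 ≤ x i ∧ x i ≤ 1}

/-- A combinatorial `n`-cube: a polytope whose face poset is isomorphic to that of `[0,1]^n`. -/
def IsCombinatorialCube (n : ℕ) (P : Set E) : Prop :=
  IsPolytope P ∧ Nonempty (Face P ≃o Face (standardCube n))

/-- A cubical `d`-polytope: a `d`-dimensional polytope all of whose nonempty proper faces are
combinatorial cubes. -/
def IsCubicalPolytope (d : ℕ) (P : Set E) : Prop :=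
  IsPolytope P ∧ dimension P = d ∧
    ∀ F : Set E, IsExposed ℝ P F → F.Nonempty → F ≠ P → ∃ k : ℕ, IsCombinatorialCube k F

/-- A neighborly cubical `d`-polytope with `2 ^ n` vertices (meant for `n ≥ d ≥ 2`): a cubical
`d`-polytope with `2 ^ n` vertices whose `(⌊d/2⌋ - 1)`-skeleton is combinatorially equivalent
to that of the `n`-cube. -/
def IsNeighborlyCubical (n d : ℕ) (P : Set E) : Prop :=
  IsCubicalPolytope d P ∧ (vertices P).ncard = 2 ^ n ∧
    Nonempty (Skeleton (d / 2 - 1) P ≃o Skeleton (d / 2 - 1) (standardCube n))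

/-- The `k`-skeleton of the polytope `P` is dimensionally ambiguous: some polytope of a different
dimension has a combinatorially equivalent `k`-skeleton. -/
def HasDimensionallyAmbiguousSkeleton (k : ℕ) (P : Set E) : Prop :=
  ∃ (m : ℕ) (Q : Set (Fin m → ℝ)), IsPolytope Q ∧ dimension Q ≠ dimension P ∧
    Nonempty (Skeleton k P ≃o Skeleton k Q)

/-- `π` restricts to an isomorphism of polytopal complexes from the `k`-skeleton of `P` to the
`k`-skeleton of `π(P)`: the map `F ↦ π(F)` is an isomorphism between the two posets of faces,
and `π` is injective on the union of the faces in the `k`-skeleton of `P`. -/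
def InducesSkeletonIso {E' : Type*} [NormedAddCommGroup E'] [NormedSpace ℝ E']
    (k : ℕ) (π : E →ₗ[ℝ] E') (P : Set E) : Prop :=
  (∃ e : Skeleton k P ≃o Skeleton k (π '' P),
      ∀ F : Skeleton k P, (e F : Set E') = π '' (F : Set E)) ∧
    Set.InjOn π (⋃ F : Skeleton k P, (F : Set E))

end Polytopes

/-- The deformed cube `C^n(ε)`: the solution set of
`ε |x_k| ≤ 2 ^ (k choose 2) / ε ^ (k - 1) - (-1) ^ k * ∑_{1 ≤ j < k} (k - 2 choose j - 1) x_j`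
for `1 ≤ k ≤ n`. The coordinate `x_k` is `x i` with `k = i + 1`, since `Fin n` starts at `0`. -/
def deformedCube (n : ℕ) (ε : ℝ) : Set (Fin n → ℝ) :=
  {x | ∀ i : Fin n,
    ε * |x i| ≤ 2 ^ (((i : ℕ) + 1).choose 2) / ε ^ (i : ℕ)
      - (-1) ^ ((i : ℕ) + 1) * ∑ j ∈ Finset.Iio i, (((i : ℕ) - 1).choose (j : ℕ) : ℝ) * x j}

/-- The projection `ℝ^n → ℝ^d`, `(x_1, …, x_n) ↦ (x_{n-d+1}, …, x_n)` to the last `d`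
coordinates. -/
def lastCoordinates {n d : ℕ} (h : d ≤ n) : (Fin n → ℝ) →ₗ[ℝ] (Fin d → ℝ) :=
  LinearMap.funLeft ℝ ℝ (fun i : Fin d => (⟨n - d + i, by omega⟩ : Fin n))

end CubicalPolytopes

open CubicalPolytopes

/-! A polytope given by inequalities has its face poset determined by which sets of constraints can
be tight together. In `C^n(ε)` the `i`-th pair of constraints confines `x_i` to an interval
depending only on earlier coordinates, and the constant terms keep that interval of positive length
(`abs_lowerSum_lt`). Hence the realizable tight sets are exactly those with at most one sign per
index, as in `[0,1]^n` (`isCubeSystem_deformedCube`).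

Projecting to the last `d` coordinates has as kernel the vectors `v` supported on the first `m = n -
d` coordinates. Read `v` as a polynomial `p` of degree less than `m` in the binomial basis. With
indices starting at `0`, the constraint normals at `ε = 0` evaluate on `v` to `(-1)^t p(t)`, where
`t = i - 1` and `i ≥ 1`; the normal at `i = 0` vanishes. Two properties follow for small `ε > 0`.

Positive spanning: on a face of dimension at most `r`, at least `n - r` constraints are tight. If
all of their normals are nonpositive on `v`, then `p` alternates weakly at `m + 1` points, because
`2r + 2 ≤ d`, so `p = 0` by a Lagrange coefficient argument (`eventually_positivelySpanning`). Some
positive combination of the normals then vanishes on the kernel, so the face is cut out by a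
functional that factors through the projection and survives with no new preimages.

Genericity: any `m` normals from different pairs are independent on the kernel
(`eventually_generic`). Thus the projection is injective on preimages of proper faces, so the image
is cubical. Parts (2) and (3) are the cases `r = d/2 - 1` and `d = 4, r = 1`. -/

namespace CubicalPolytopes

/-! ### Polytopes cut out by inequalities, and faces encoded by tight sets. -/

section FacetSystems

variable {E E' : Type*} [NormedAddCommGroup E] [NormedSpace ℝ E]
  [NormedAddCommGroup E'] [NormedSpace ℝ E'] {J : Type*}

/-- The indices of the constraints `l j ≤ c j` that hold with equality at `x`. -/
def tightSet (l : J → E →L[ℝ] ℝ) (c : J → ℝ) (x : E) : Set J :=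
  {j | l j x = c j}

/-- The points of `P` at which all constraints in `T` are tight. -/
def faceOn (l : J → E →L[ℝ] ℝ) (c : J → ℝ) (P : Set E) (T : Set J) : Set E :=
  {x | x ∈ P ∧ T ⊆ tightSet l c x}

/-- The convex set `P` is cut out, inside some affine subspace, by the constraints `l j ≤ c j`:
whenever all constraints tight at `x` are tight at `z`, the segment from `z` to `x` can be
prolonged beyond `x`. -/
structure IsFacetSystem (l : J → E →L[ℝ] ℝ) (c : J → ℝ) (P : Set E) : Prop where
  convex : Convex ℝ P
  le : ∀ x ∈ P, ∀ j, l j x ≤ c j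
  extend : ∀ x ∈ P, ∀ z ∈ P, tightSet l c x ⊆ tightSet l c z →
    ∃ δ : ℝ, 0 < δ ∧ x + δ • (x - z) ∈ P

/-- The solution set of a system of linear inequalities. -/
def polyhedron (l : J → E →L[ℝ] ℝ) (c : J → ℝ) : Set E :=
  {x | ∀ j, l j x ≤ c j}

/-- Tight constraints are unchanged along `w`, and the finitely many slack ones stay slack for a
short time. -/
theorem exists_add_smul_mem_polyhedron [Finite J] {l : J → E →L[ℝ] ℝ} {c : J → ℝ} {x w : E}
    (hx : x ∈ polyhedron l c) (hw : ∀ j ∈ tightSet l c x, l j w = 0) :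
    ∃ δ : ℝ, 0 < δ ∧ x + δ • w ∈ polyhedron l c := by
  have h : ∀ j, ∀ᶠ δ : ℝ in nhdsWithin 0 (Set.Ioi 0), l j (x + δ • w) ≤ c j := by
    intro j
    rcases (hx j).eq_or_lt with h | h
    · exact Filter.Eventually.of_forall fun δ => by simp [hw j h, h]
    · have hc : Continuous fun δ : ℝ => l j (x + δ • w) := by fun_prop
      have := hc.continuousAt.eventually_lt (x₀ := 0) (continuousAt_const (y := c j))
        (by simpa using h)
      exact (this.filter_mono nhdsWithin_le_nhds).mono fun _ h => h.le
  obtain ⟨δ, h1, h2⟩ := ((Filter.eventually_all.2 h).and self_mem_nhdsWithin).exists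
  exact ⟨δ, h2, h1⟩

theorem convex_polyhedron (l : J → E →L[ℝ] ℝ) (c : J → ℝ) : Convex ℝ (polyhedron l c) := by
  intro x hx y hy a b ha hb hab j
  have := add_le_add (mul_le_mul_of_nonneg_left (hx j) ha) (mul_le_mul_of_nonneg_left (hy j) hb)
  simpa [← add_mul, hab] using this

theorem isClosed_polyhedron (l : J → E →L[ℝ] ℝ) (c : J → ℝ) : IsClosed (polyhedron l c) := by
  simp only [polyhedron, Set.ofPred_forall]
  exact isClosed_iInter fun j => isClosed_le (l j).continuous continuous_const

theorem isFacetSystem_polyhedron [Finite J] (l : J → E →L[ℝ] ℝ) (c : J → ℝ) :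
    IsFacetSystem l c (polyhedron l c) where
  convex := convex_polyhedron l c
  le _ hx := hx
  extend x hx z _ h := exists_add_smul_mem_polyhedron hx fun j hj => by
    have h1 : l j x = c j := hj
    have h2 : l j z = c j := h hj
    rw [map_sub, h1, h2, sub_self]

variable {l : J → E →L[ℝ] ℝ} {c : J → ℝ} {P F : Set E} {T : Set J}

theorem faceOn_anti {T' : Set J} (h : T ⊆ T') : faceOn l c P T' ⊆ faceOn l c P T :=
  fun _ hx => ⟨hx.1, h.trans hx.2⟩

namespace IsFacetSystem

/-- The sum of the functionals in `T` exposes this set: on `P` it attains the sum of the bounds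
exactly when each summand is tight. -/
theorem isExposed_faceOn [Finite J] (hP : IsFacetSystem l c P) (T : Set J) :
    IsExposed ℝ P (faceOn l c P T) := by
  classical
  rintro ⟨z, hzP, hz⟩
  have := Fintype.ofFinite J
  refine ⟨∑ j ∈ T.toFinset, l j, Set.ext fun x => ⟨?_, ?_⟩⟩
  · rintro ⟨hx, hT⟩
    refine ⟨hx, fun y hy => ?_⟩
    simp only [sum_apply]
    refine Finset.sum_le_sum fun j hj => (hP.le y hy j).trans (hT ?_).ge
    simpa using hj
  · rintro ⟨hx, hmax⟩
    refine ⟨hx, fun j hj => ?_⟩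
    have h1 := hmax z hzP
    simp only [sum_apply] at h1
    have h2 : ∑ j ∈ T.toFinset, l j z = ∑ j ∈ T.toFinset, c j :=
      Finset.sum_congr rfl fun j hj => hz (by simpa using hj)
    rw [h2] at h1
    have h3 : ∑ j ∈ T.toFinset, l j x ≤ ∑ j ∈ T.toFinset, c j :=
      Finset.sum_le_sum fun j _ => hP.le x hx j
    exact (Finset.sum_eq_sum_iff_of_le fun j _ => hP.le x hx j).1 (le_antisymm h3 h1) j
      (by simpa using hj)

theorem tightSet_midpoint_subset (hP : IsFacetSystem l c P) {x y : E} (hx : x ∈ P) (hy : y ∈ P) :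
    tightSet l c ((1 / 2 : ℝ) • x + (1 / 2 : ℝ) • y) ⊆ tightSet l c x ∩ tightSet l c y := by
  intro j hj
  have h1 := hP.le x hx j
  have h2 := hP.le y hy j
  simp only [tightSet, Set.mem_ofPred_eq, map_add, map_smul, smul_eq_mul] at hj
  constructor <;> simp only [tightSet, Set.mem_ofPred_eq] <;> linarith

/-- The point `x` plays the role of a relative interior point: its tight set is minimal over `F`.
Midpoints show that its tight constraints are tight on all of `F`. Conversely, for `z` satisfying
them, `x` lies strictly between `z` and another point of `P`, so a functional maximal at `x` is
maximal at `z`. -/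
theorem exists_eq_faceOn [Finite J] (hP : IsFacetSystem l c P) (hF : IsExposed ℝ P F)
    (hne : F.Nonempty) : ∃ x ∈ F, F = faceOn l c P (tightSet l c x) := by
  obtain ⟨-, ⟨x, hx, rfl⟩, hmin⟩ :=
    (Set.toFinite (tightSet l c '' F)).exists_minimal (hne.image _)
  refine ⟨x, hx, Set.Subset.antisymm (fun y hy => ?_) fun z hz => ?_⟩
  · refine ⟨hF.subset hy, ?_⟩
    have hm := hP.tightSet_midpoint_subset (hF.subset hx) (hF.subset hy)
    have hmF : (1 / 2 : ℝ) • x + (1 / 2 : ℝ) • y ∈ F :=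
      hF.convex hP.convex hx hy (by norm_num) (by norm_num) (by norm_num)
    exact (hmin (Set.mem_image_of_mem _ hmF) (hm.trans Set.inter_subset_left)).trans
      (hm.trans Set.inter_subset_right)
  · obtain ⟨f, rfl⟩ := hF hne
    obtain ⟨δ, hδ, hmem⟩ := hP.extend x hx.1 z hz.1 hz.2
    have h := hx.2 _ hmem
    simp only [map_add, map_smul, map_sub, smul_eq_mul] at h
    have h1 : f x ≤ f z := by
      by_contra! h2
      have := mul_pos hδ (sub_pos.2 h2)
      linarith
    exact ⟨hz.1, fun y hy => (hx.2 y hy).trans h1⟩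

/-- A compact set cut out by finitely many linear inequalities is a polytope. -/
theorem isPolytope [Finite J] (hP : IsFacetSystem l c P) (hc : IsCompact P) (hne : P.Nonempty) :
    IsPolytope P := by
  -- If an extreme point `x` shared its tight set with another point `y`, the segment from `y` could
  -- be prolonged beyond `x`. So there are only finitely many extreme points, and Krein–Milman
  -- applies.
  have hinj : Set.InjOn (tightSet l c) (P.extremePoints ℝ) := by
    intro x hx y hy h
    obtain ⟨δ, hδ, hmem⟩ := hP.extend x hx.1 y hy.1 h.le
    refine (hx.2 hy.1 hmem ⟨δ / (1 + δ), 1 / (1 + δ), by positivity, by positivity,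
      by field_simp; ring, ?_⟩).symm
    have h1 : (1 + δ) ≠ 0 := by positivity
    rw [smul_add, smul_smul, smul_sub]
    have : δ / (1 + δ) = 1 / (1 + δ) * δ := by ring
    rw [this]
    have h2 : (1 / (1 + δ)) • x + (1 / (1 + δ) * δ) • x = x := by
      rw [← add_smul]
      have : 1 / (1 + δ) + 1 / (1 + δ) * δ = 1 := by field_simp
      rw [this, one_smul]
    calc _ = (1 / (1 + δ)) • x + (1 / (1 + δ) * δ) • x := by abel
      _ = x := h2
  have hfin : (P.extremePoints ℝ).Finite := Set.Finite.of_finite_image (Set.toFinite _) hinj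
  have hP' := closure_convexHull_extremePoints hc hP.convex
  rw [(hfin.isCompact_convexHull ℝ).isClosed.closure_eq] at hP'
  refine ⟨hfin.toFinset, ?_, by simpa using hP'.symm⟩
  rw [Set.Finite.toFinset_nonempty]
  exact hc.extremePoints_nonempty hne

end IsFacetSystem

/-- The points of `P'` with the same tight constraints as some point of `F`. -/
def transferFace (l : J → E →L[ℝ] ℝ) (c : J → ℝ) (l' : J → E' →L[ℝ] ℝ) (c' : J → ℝ) (P' : Set E')
    (F : Set E) : Set E' :=
  {y | y ∈ P' ∧ ∃ x ∈ F, tightSet l c x = tightSet l' c' y}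

variable {l' : J → E' →L[ℝ] ℝ} {c' : J → ℝ} {P' : Set E'}

theorem transferFace_mono {F G : Set E} (h : F ⊆ G) :
    transferFace l c l' c' P' F ⊆ transferFace l c l' c' P' G :=
  fun _ hy => ⟨hy.1, hy.2.imp fun _ hx => ⟨h hx.1, hx.2⟩⟩

theorem transferFace_faceOn (hcells : tightSet l' c' '' P' ⊆ tightSet l c '' P) (T : Set J) :
    transferFace l c l' c' P' (faceOn l c P T) = faceOn l' c' P' T := by
  ext y
  constructor
  · rintro ⟨hy, x, hx, h⟩
    exact ⟨hy, h ▸ hx.2⟩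
  · rintro ⟨hy, hT⟩
    obtain ⟨x, hx, h⟩ := hcells (Set.mem_image_of_mem _ hy)
    exact ⟨hy, x, ⟨hx, h ▸ hT⟩, h⟩

theorem transferFace_empty : transferFace l c l' c' P' ∅ = ∅ := by
  simp [transferFace]

theorem IsFacetSystem.isExposed_transferFace [Finite J] (hP : IsFacetSystem l c P)
    (hP' : IsFacetSystem l' c' P') (hcells : tightSet l' c' '' P' ⊆ tightSet l c '' P)
    (hF : IsExposed ℝ P F) : IsExposed ℝ P' (transferFace l c l' c' P' F) := by
  obtain rfl | hne := F.eq_empty_or_nonempty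
  · rw [transferFace_empty]
    exact isExposed_empty
  · obtain ⟨x, -, hx⟩ := hP.exists_eq_faceOn hF hne
    rw [hx, transferFace_faceOn hcells]
    exact hP'.isExposed_faceOn _

theorem IsFacetSystem.transferFace_transferFace [Finite J] (hP : IsFacetSystem l c P)
    (hcells : tightSet l c '' P = tightSet l' c' '' P') (hF : IsExposed ℝ P F) :
    transferFace l' c' l c P (transferFace l c l' c' P' F) = F := by
  obtain rfl | hne := F.eq_empty_or_nonempty
  · rw [transferFace_empty, transferFace_empty]
  · obtain ⟨x, -, hx⟩ := hP.exists_eq_faceOn hF hne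
    rw [hx, transferFace_faceOn hcells.ge, transferFace_faceOn hcells.le]

/-- Two facet systems with the same sets of simultaneously tight constraints have isomorphic
face posets. -/
def IsFacetSystem.faceIso [Finite J] (hP : IsFacetSystem l c P) (hP' : IsFacetSystem l' c' P')
    (hcells : tightSet l c '' P = tightSet l' c' '' P') : Face P ≃o Face P' where
  toFun F := ⟨transferFace l c l' c' P' F, hP.isExposed_transferFace hP' hcells.ge F.2⟩
  invFun F := ⟨transferFace l' c' l c P F, hP'.isExposed_transferFace hP hcells.le F.2⟩
  left_inv F := Subtype.ext (hP.transferFace_transferFace hcells F.2)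
  right_inv F := Subtype.ext (hP'.transferFace_transferFace hcells.symm F.2)
  map_rel_iff' {F G} := by
    refine ⟨fun h => ?_, fun h => transferFace_mono h⟩
    have := transferFace_mono (l := l') (c := c') (l' := l) (c' := c) (P' := P)
      (show transferFace l c l' c' P' (F : Set E) ⊆ transferFace l c l' c' P' (G : Set E) from h)
    rwa [hP.transferFace_transferFace hcells F.2, hP.transferFace_transferFace hcells G.2] at this

/-- A face isomorphism that preserves dimensions restricts to skeleta. -/
theorem nonempty_skeletonIso {P : Set E} {P' : Set E'} (e : Face P ≃o Face P')
    (he : ∀ F : Face P, dimension (e F : Set E') = dimension (F : Set E)) (k : ℕ) :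
    Nonempty (Skeleton k P ≃o Skeleton k P') := by
  have he' : ∀ F : Face P', dimension (e.symm F : Set E) = dimension (F : Set E') := fun F => by
    rw [← he, e.apply_symm_apply]
  exact ⟨{
    toFun F := ⟨e ⟨F.1, F.2.1⟩, (e ⟨F.1, F.2.1⟩).2, (he _).trans_le F.2.2⟩
    invFun F := ⟨e.symm ⟨F.1, F.2.1⟩, (e.symm ⟨F.1, F.2.1⟩).2, (he' _).trans_le F.2.2⟩
    left_inv F := Subtype.ext (by simp)
    right_inv F := Subtype.ext (by simp)
    map_rel_iff' {F G} := e.le_iff_le (x := ⟨F.1, F.2.1⟩) (y := ⟨G.1, G.2.1⟩) }⟩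

end FacetSystems

end CubicalPolytopes

namespace CubicalPolytopes

/-! ### Systems whose tight sets are those of a cube. -/

section CubeSystems

variable {E E' : Type*} [NormedAddCommGroup E] [NormedSpace ℝ E]
  [NormedAddCommGroup E'] [NormedSpace ℝ E'] {ι κ : Type*}

/-- A set of pairs (index, sign) using at most one sign for each index. -/
def IsConsistent (T : Set (ι × Bool)) : Prop :=
  ∀ i, (i, true) ∈ T → (i, false) ∉ T

theorem IsConsistent.mono {T T' : Set (ι × Bool)} (h : IsConsistent T) (hT : T' ⊆ T) :
    IsConsistent T' :=
  fun i h1 h2 => h i (hT h1) (hT h2)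

theorem IsConsistent.eq_of_mem {T : Set (ι × Bool)} (h : IsConsistent T) {i : ι} {a b : Bool}
    (ha : (i, a) ∈ T) (hb : (i, b) ∈ T) : a = b := by
  cases a <;> cases b <;> first | rfl | exact absurd ha (h i hb) | exact absurd hb (h i ha)

theorem isConsistent_iff {T : Set (ι × Bool)} :
    IsConsistent T ↔ ∀ i a b, (i, a) ∈ T → (i, b) ∈ T → a = b :=
  ⟨fun h _ _ _ ha hb => h.eq_of_mem ha hb, fun h i h1 h2 => by simpa using h i _ _ h1 h2⟩

theorem IsConsistent.exists_finset [Finite ι] {T : Set (ι × Bool)} (h : IsConsistent T) :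
    ∃ (S : Finset ι) (s : ι → Bool), S.card = T.ncard ∧ ∀ i a, (i, a) ∈ T ↔ i ∈ S ∧ a = s i := by
  classical
  have := Fintype.ofFinite ι
  have hT : T.InjOn Prod.fst := by
    rintro ⟨i, a⟩ hi ⟨_, b⟩ hj rfl
    rw [h.eq_of_mem hi hj]
  refine ⟨(Prod.fst '' T).toFinset, fun i => decide ((i, true) ∈ T), ?_, fun i a => ?_⟩
  · rw [← Set.ncard_eq_toFinset_card', hT.ncard_image]
  · simp only [Set.mem_toFinset, Set.mem_image, Prod.exists, exists_and_right, exists_eq_right]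
    constructor
    · intro ha
      refine ⟨⟨a, ha⟩, ?_⟩
      cases a
      · simpa using fun h' => h i h' ha
      · simpa using ha
    · rintro ⟨⟨b, hb⟩, rfl⟩
      by_cases h' : (i, true) ∈ T
      · simp [h']
      · cases b
        · simpa [h'] using hb
        · exact absurd hb h'

/-- A facet system whose constraints come in opposite pairs indexed by `ι`, such that the sets of
simultaneously tight constraints are those of a cube. -/
structure IsCubeSystem (l : ι × Bool → E →L[ℝ] ℝ) (c : ι × Bool → ℝ) (P : Set E) : Prop
    extends IsFacetSystem l c P where
  consistent : ∀ x ∈ P, IsConsistent (tightSet l c x)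
  exists_tightSet_eq : ∀ T, IsConsistent T → ∃ x ∈ P, tightSet l c x = T

theorem map_eq_zero_of_mem_vectorSpan_faceOn {J : Type*} {l : J → E →L[ℝ] ℝ} {c : J → ℝ}
    {P : Set E} {T : Set J} {w : E} (hw : w ∈ vectorSpan ℝ (faceOn l c P T)) {j : J}
    (hj : j ∈ T) : l j w = 0 := by
  have h : vectorSpan ℝ (faceOn l c P T) ≤ LinearMap.ker (l j : E →ₗ[ℝ] ℝ) := by
    refine Submodule.span_le.2 ?_
    rintro - ⟨x, hx, y, hy, rfl⟩
    have h1 : l j x = c j := hx.2 hj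
    have h2 : l j y = c j := hy.2 hj
    simp [h1, h2]
  exact h hw

theorem dimension_empty : dimension (∅ : Set E) = 0 := by
  rw [dimension, vectorSpan_empty, finrank_bot]

theorem dimension_singleton (x : E) : dimension ({x} : Set E) = 0 := by
  rw [dimension, vectorSpan_singleton, finrank_bot]

namespace IsCubeSystem

variable {l : ι × Bool → E →L[ℝ] ℝ} {c : ι × Bool → ℝ} {P : Set E}
  {l' : ι × Bool → E' →L[ℝ] ℝ} {c' : ι × Bool → ℝ} {P' : Set E'}

theorem image_tightSet (hP : IsCubeSystem l c P) :
    tightSet l c '' P = {T | IsConsistent T} := by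
  ext T
  constructor
  · rintro ⟨x, hx, rfl⟩
    exact hP.consistent x hx
  · exact hP.exists_tightSet_eq T

theorem nonempty (hP : IsCubeSystem l c P) : P.Nonempty :=
  let ⟨x, hx, _⟩ := hP.exists_tightSet_eq ∅ (by simp [IsConsistent])
  ⟨x, hx⟩

theorem nonempty_faceIso [Finite ι] (hP : IsCubeSystem l c P) (hP' : IsCubeSystem l' c' P') :
    Nonempty (Face P ≃o Face P') :=
  ⟨hP.faceIso hP'.toIsFacetSystem (hP.image_tightSet.trans hP'.image_tightSet.symm)⟩

/-- A constraint `j` in `T'` but not in `T` is constant on the smaller face, but it separates a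
point with tight set exactly `T` from one with tight set `T'`. -/
theorem dimension_faceOn_lt [FiniteDimensional ℝ E] (hP : IsCubeSystem l c P)
    {T T' : Set (ι × Bool)} (hT' : IsConsistent T') (hTT' : T ⊂ T') :
    dimension (faceOn l c P T') < dimension (faceOn l c P T) := by
  obtain ⟨j, hj, hjT⟩ := Set.exists_of_ssubset hTT'
  obtain ⟨x, hx, hxT⟩ := hP.exists_tightSet_eq T (hT'.mono hTT'.subset)
  obtain ⟨y, hy, hyT⟩ := hP.exists_tightSet_eq T' hT'
  refine Submodule.finrank_lt_finrank_of_lt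
    (lt_of_le_of_ne (vectorSpan_mono ℝ (faceOn_anti hTT'.subset)) fun h => ?_)
  have hmem : x - y ∈ vectorSpan ℝ (faceOn l c P T) :=
    vsub_mem_vectorSpan ℝ ⟨hx, hxT.ge⟩ ⟨hy, hTT'.subset.trans hyT.ge⟩
  rw [← h] at hmem
  have h1 := map_eq_zero_of_mem_vectorSpan_faceOn hmem hj
  have h2 : l j y = c j := hyT.ge hj
  rw [map_sub, h2, sub_eq_zero] at h1
  exact hjT (hxT ▸ h1)

/-- In a full-dimensional cube, each tight constraint lowers the dimension of a face by one. -/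
theorem dimension_faceOn_add_ncard [FiniteDimensional ℝ E] [Fintype ι] (hP : IsCubeSystem l c P)
    (hE : Module.finrank ℝ E = Fintype.card ι) {T : Set (ι × Bool)} (hT : IsConsistent T) :
    dimension (faceOn l c P T) + T.ncard = Fintype.card ι := by
  classical
  -- Strict drops are counted along two chains: from the whole polytope down to `T` for the upper
  -- bound, and from `T` down to a complete choice of signs for the lower bound.
  have hle : ∀ k : ℕ, ∀ T : Set (ι × Bool), IsConsistent T → T.ncard = k →
      dimension (faceOn l c P T) + k ≤ Fintype.card ι := by
    intro k
    induction k with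
    | zero => exact fun T _ _ => hE ▸ Submodule.finrank_le _
    | succ k ih =>
      intro T hT hk
      obtain ⟨j, hj⟩ : T.Nonempty := Set.nonempty_of_ncard_ne_zero (by omega)
      have h1 := ih (T \ {j}) (hT.mono Set.sdiff_subset)
        (by rw [Set.ncard_sdiff_singleton_of_mem hj]; omega)
      have h2 := hP.dimension_faceOn_lt hT (Set.sdiff_singleton_ssubset.2 hj)
      omega
  have hge : ∀ k : ℕ, ∀ T : Set (ι × Bool), IsConsistent T → Fintype.card ι = T.ncard + k →
      k ≤ dimension (faceOn l c P T) := by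
    intro k
    induction k with
    | zero => exact fun T _ _ => Nat.zero_le _
    | succ k ih =>
      intro T hT hk
      obtain ⟨S, s, hS, hSs⟩ := hT.exists_finset
      obtain ⟨i, hi⟩ : ∃ i, i ∉ S := by
        by_contra! h
        rw [← hS, Finset.eq_univ_iff_forall.2 h, Finset.card_univ] at hk
        omega
      have hiT : ∀ a, (i, a) ∉ T := fun a ha => hi ((hSs i a).1 ha).1
      have hT' : IsConsistent (insert (i, true) T) := by
        intro k h1 h2
        simp only [Set.mem_insert_iff, Prod.mk.injEq, and_true, Bool.false_eq_true,
          and_false, false_or] at h1 h2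
        rcases h1 with rfl | h1
        · exact hiT _ h2
        · exact hT k h1 h2
      have h1 := ih _ hT' (by rw [Set.ncard_insert_of_notMem (hiT _)]; omega)
      have h2 := hP.dimension_faceOn_lt hT' (Set.ssubset_insert (hiT true))
      omega
  have h1 := hle _ T hT rfl
  have h2 := hge (Fintype.card ι - T.ncard) T hT (by omega)
  omega

theorem dimension_eq_card [FiniteDimensional ℝ E] [Fintype ι] (hP : IsCubeSystem l c P)
    (hE : Module.finrank ℝ E = Fintype.card ι) : dimension P = Fintype.card ι := by
  have h := hP.dimension_faceOn_add_ncard hE (T := ∅) (by simp [IsConsistent])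
  have h' : faceOn l c P ∅ = P := by simp [faceOn]
  simpa [h'] using h

theorem nonempty_skeletonIso [FiniteDimensional ℝ E] [FiniteDimensional ℝ E'] [Fintype ι]
    (hP : IsCubeSystem l c P) (hP' : IsCubeSystem l' c' P')
    (hE : Module.finrank ℝ E = Fintype.card ι) (hE' : Module.finrank ℝ E' = Fintype.card ι)
    (k : ℕ) : Nonempty (Skeleton k P ≃o Skeleton k P') := by
  have hcells := hP.image_tightSet.trans hP'.image_tightSet.symm
  refine CubicalPolytopes.nonempty_skeletonIso (hP.faceIso hP'.toIsFacetSystem hcells) ?_ k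
  rintro ⟨F, hF⟩
  change dimension (transferFace l c l' c' P' F) = dimension F
  obtain rfl | hne := F.eq_empty_or_nonempty
  · rw [transferFace_empty, dimension_empty, dimension_empty]
  · obtain ⟨x, hxF, hx⟩ := hP.exists_eq_faceOn hF hne
    have hT := hP.consistent x (hF.subset hxF)
    rw [hx, transferFace_faceOn hcells.ge]
    have h1 := hP.dimension_faceOn_add_ncard hE hT
    have h2 := hP'.dimension_faceOn_add_ncard hE' hT
    omega

/-- A face of a cube is cut out by the pairs of constraints that are not tight on it. -/
theorem isCubeSystem_faceOn [Finite ι] (hP : IsCubeSystem l c P) {T : Set (ι × Bool)}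
    (hT : IsConsistent T) {f : κ → ι} (hf : Function.Injective f)
    (hrange : ∀ i, i ∈ Set.range f ↔ ∀ a, (i, a) ∉ T) :
    IsCubeSystem (fun p : κ × Bool => l (f p.1, p.2)) (fun p => c (f p.1, p.2))
      (faceOn l c P T) where
  convex := (hP.isExposed_faceOn T).convex hP.convex
  le x hx p := hP.le x hx.1 _
  extend x hx z hz h := by
    have h' : tightSet l c x ⊆ tightSet l c z := by
      rintro ⟨i, a⟩ ha
      by_cases hi : i ∈ Set.range f
      · obtain ⟨k, rfl⟩ := hi
        exact h (a := (k, a)) ha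
      · rw [hrange] at hi
        push Not at hi
        obtain ⟨b, hb⟩ := hi
        rw [(hP.consistent x hx.1).eq_of_mem ha (hx.2 hb)]
        exact hz.2 hb
    obtain ⟨δ, hδ, hmem⟩ := hP.extend x hx.1 z hz.1 h'
    refine ⟨δ, hδ, hmem, fun j hj => ?_⟩
    have h1 : l j x = c j := hx.2 hj
    have h2 : l j z = c j := hz.2 hj
    simp [tightSet, h1, h2]
  consistent x hx i h1 h2 := hP.consistent x hx.1 (f i) h1 h2
  exists_tightSet_eq T' hT' := by
    have hfree : ∀ k a, (f k, a) ∉ T := fun k => (hrange _).1 ⟨k, rfl⟩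
    -- `T` uses only fixed indices and the image of `T'` only free ones, so their union is still
    -- consistent.
    obtain ⟨x, hx, hxT⟩ := hP.exists_tightSet_eq (T ∪ (fun p => (f p.1, p.2)) '' T') (by
      rw [isConsistent_iff]
      rintro i a b (ha | ⟨⟨k, a⟩, ha, h⟩) (hb | ⟨⟨k', b⟩, hb, h'⟩)
      · exact hT.eq_of_mem ha hb
      · simp only [Prod.mk.injEq] at h'
        exact absurd (h'.1 ▸ ha) (hfree _ _)
      · simp only [Prod.mk.injEq] at h
        exact absurd (h.1 ▸ hb) (hfree _ _)
      · simp only [Prod.mk.injEq] at h h'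
        obtain rfl := hf (h.1.trans h'.1.symm)
        exact h.2 ▸ h'.2 ▸ hT'.eq_of_mem ha hb)
    refine ⟨x, ⟨hx, Set.subset_union_left.trans hxT.ge⟩, Set.ext fun p => ?_⟩
    have : p ∈ tightSet (fun p : κ × Bool => l (f p.1, p.2)) (fun p => c (f p.1, p.2)) x ↔
        (f p.1, p.2) ∈ tightSet l c x := Iff.rfl
    rw [this, hxT]
    constructor
    · rintro (h | ⟨q, hq, h⟩)
      · exact absurd h (hfree _ _)
      · simp only [Prod.mk.injEq] at h
        rwa [← Prod.ext (hf h.1) h.2]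
    · exact fun h => Or.inr ⟨p, h, rfl⟩

end IsCubeSystem

section StandardCube

/-- The constraints `x i ≤ 1` and `-x i ≤ 0` of the standard cube. -/
noncomputable def standardFunctional (n : ℕ) (p : Fin n × Bool) : (Fin n → ℝ) →L[ℝ] ℝ :=
  (if p.2 then 1 else -1 : ℝ) • ContinuousLinearMap.proj p.1

/-- The right-hand sides of the constraints of the standard cube. -/
def standardBound (n : ℕ) (p : Fin n × Bool) : ℝ :=
  if p.2 then 1 else 0

theorem standardCube_eq_polyhedron (n : ℕ) :
    standardCube n = polyhedron (standardFunctional n) (standardBound n) := by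
  ext x
  simp [standardCube, polyhedron, standardFunctional, standardBound]

theorem isCubeSystem_standardCube (n : ℕ) :
    IsCubeSystem (standardFunctional n) (standardBound n) (standardCube n) where
  toIsFacetSystem := standardCube_eq_polyhedron n ▸ isFacetSystem_polyhedron _ _
  consistent x _ i h1 h2 := by
    simp [tightSet, standardFunctional, standardBound] at h1 h2
    linarith
  exists_tightSet_eq T hT := by
    classical
    refine ⟨fun i => if (i, true) ∈ T then 1 else if (i, false) ∈ T then 0 else 1 / 2,
      fun i => ?_, ?_⟩
    · dsimp only
      split_ifs <;> norm_num
    · ext ⟨i, a⟩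
      have := hT i
      cases a
      · simp only [tightSet, standardFunctional, standardBound, Set.mem_ofPred_eq]
        by_cases h1 : (i, true) ∈ T
        · simp [h1, this h1]
        · by_cases h2 : (i, false) ∈ T <;> simp [h1, h2]
      · simp only [tightSet, standardFunctional, standardBound, Set.mem_ofPred_eq]
        by_cases h1 : (i, true) ∈ T
        · simp [h1]
        · by_cases h2 : (i, false) ∈ T <;> simp [h1, h2]

theorem isCompact_standardCube (n : ℕ) : IsCompact (standardCube n) := by
  have : standardCube n = Set.Icc 0 1 := by
    ext x
    simp [standardCube, Set.mem_Icc, Pi.le_def, forall_and]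
  exact this ▸ isCompact_Icc

theorem dimension_standardCube (n : ℕ) : dimension (standardCube n) = n := by
  simpa using (isCubeSystem_standardCube n).dimension_eq_card (by simp)

theorem IsCubeSystem.isCombinatorialCube {n : ℕ} {l : Fin n × Bool → E →L[ℝ] ℝ}
    {c : Fin n × Bool → ℝ} {P : Set E} (hP : IsCubeSystem l c P) (hc : IsCompact P) :
    IsCombinatorialCube n P :=
  ⟨hP.isPolytope hc hP.nonempty, hP.nonempty_faceIso (isCubeSystem_standardCube n)⟩

theorem IsCubeSystem.exists_isCombinatorialCube [Finite ι] {l : ι × Bool → E →L[ℝ] ℝ}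
    {c : ι × Bool → ℝ} {P F : Set E} (hP : IsCubeSystem l c P) (hc : IsCompact P)
    (hF : IsExposed ℝ P F) (hne : F.Nonempty) : ∃ k, IsCombinatorialCube k F := by
  have hFc := hF.isCompact hc
  obtain ⟨x, hx, hxF⟩ := hP.exists_eq_faceOn hF hne
  have e := Finite.equivFin {i : ι // ∀ a, (i, a) ∉ tightSet l c x}
  refine ⟨_, (IsCubeSystem.isCombinatorialCube (hxF ▸ hP.isCubeSystem_faceOn
    (hP.consistent x (hF.subset hx)) (f := fun k => (e.symm k : ι))
    (Subtype.val_injective.comp e.symm.injective) fun i => ?_) hFc)⟩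
  constructor
  · rintro ⟨k, rfl⟩
    exact (e.symm k).2
  · exact fun h => ⟨e ⟨i, h⟩, by simp⟩

end StandardCube

end CubeSystems

end CubicalPolytopes

namespace CubicalPolytopes

/-! ### The deformed cube is a combinatorial cube. -/

section DeformedCube

variable {n : ℕ}

/-- The part of the `i`-th constraint of the deformed cube that involves the earlier
coordinates. -/
noncomputable def lowerSum (x : Fin n → ℝ) (i : Fin n) : ℝ :=
  ∑ j ∈ Finset.Iio i, (((i : ℕ) - 1).choose (j : ℕ) : ℝ) * x j

/-- The constant term of the `i`-th constraint of the deformed cube. -/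
noncomputable def deformedConst (ε : ℝ) (i : ℕ) : ℝ :=
  2 ^ ((i + 1).choose 2) / ε ^ i

theorem deformedConst_pos {ε : ℝ} (hε : 0 < ε) (i : ℕ) : 0 < deformedConst ε i := by
  unfold deformedConst
  positivity

/-- The functionals `± ε x_i - (-1) ^ i * lowerSum x i` defining the deformed cube. -/
noncomputable def deformedFunctional (n : ℕ) (ε : ℝ) (p : Fin n × Bool) : (Fin n → ℝ) →L[ℝ] ℝ :=
  (if p.2 then ε else -ε : ℝ) • ContinuousLinearMap.proj p.1 -
    ((-1) ^ (p.1 : ℕ) : ℝ) • ∑ j ∈ Finset.Iio p.1,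
      (((p.1 : ℕ) - 1).choose (j : ℕ) : ℝ) • ContinuousLinearMap.proj j

theorem deformedFunctional_apply (ε : ℝ) (p : Fin n × Bool) (x : Fin n → ℝ) :
    deformedFunctional n ε p x =
      (if p.2 then ε else -ε) * x p.1 - (-1) ^ (p.1 : ℕ) * lowerSum x p.1 := by
  obtain ⟨i, a⟩ := p
  cases a <;> simp [deformedFunctional, lowerSum, sum_apply]

/-- The right-hand sides of the constraints of the deformed cube. -/
noncomputable def deformedBound (n : ℕ) (ε : ℝ) (p : Fin n × Bool) : ℝ :=
  deformedConst ε p.1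

theorem mem_deformedCube_iff {ε : ℝ} (hε : 0 < ε) {x : Fin n → ℝ} :
    x ∈ deformedCube n ε ↔
      ∀ i : Fin n, |ε * x i| ≤ deformedConst ε i + (-1) ^ (i : ℕ) * lowerSum x i := by
  refine forall_congr' fun i => ?_
  rw [abs_mul, abs_of_pos hε, pow_succ, deformedConst, lowerSum]
  ring_nf

theorem deformedCube_eq_polyhedron {ε : ℝ} (hε : 0 < ε) :
    deformedCube n ε = polyhedron (deformedFunctional n ε) (deformedBound n ε) := by
  ext x
  rw [mem_deformedCube_iff hε]
  constructor
  · rintro h ⟨i, a⟩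
    have := abs_le.1 (h i)
    cases a <;> simp [deformedFunctional_apply, deformedBound] <;> linarith
  · intro h i
    have h1 := h (i, true)
    have h2 := h (i, false)
    simp [deformedFunctional_apply, deformedBound] at h1 h2
    exact abs_le.2 ⟨by linarith, by linarith⟩

/-- This is what the constant terms are designed for: it makes the interval allowed for `x_i`
nondegenerate. By induction `|x_j| < 2 * deformedConst ε j / ε` for `j < i`, and the binomial
weights sum to a power of two. -/
theorem abs_lowerSum_lt {ε : ℝ} (hε : 0 < ε) (hε1 : ε ≤ 1) {x : Fin n → ℝ} (i : Fin n)
    (hx : ∀ j < i, |ε * x j| ≤ deformedConst ε j + (-1) ^ (j : ℕ) * lowerSum x j) :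
    |lowerSum x i| < deformedConst ε i := by
  induction i using WellFoundedLT.induction with
  | ind i ih =>
  obtain ⟨i, hi⟩ := i
  obtain _ | i := i
  · have : (Finset.Iio (⟨0, hi⟩ : Fin n)) = ∅ := by
      ext j
      simp [Fin.lt_def]
    simp [lowerSum, this, deformedConst_pos hε]
  · have hbound : ∀ j : Fin n, (j : ℕ) < i + 1 →
        |x j| < 2 * (2 ^ ((i + 1).choose 2) / ε ^ (i + 1)) := by
      intro j hj
      have h1 := ih j hj fun k hk => hx k (hk.trans hj)
      have h2 := hx j hj
      have h3 : |(-1) ^ (j : ℕ) * lowerSum x j| = |lowerSum x j| := by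
        rw [abs_mul, abs_pow, abs_neg, abs_one, one_pow, one_mul]
      have h4 := le_abs_self ((-1) ^ (j : ℕ) * lowerSum x j)
      rw [abs_mul, abs_of_pos hε] at h2
      have h5 : ε * |x j| < 2 * deformedConst ε j := by linarith
      have h6 : |x j| < 2 * deformedConst ε j / ε := by
        rw [lt_div_iff₀ hε]
        linarith
      refine h6.trans_le ?_
      rw [mul_div_assoc, deformedConst, div_div, ← pow_succ]
      have h7 : ((j : ℕ) + 1).choose 2 ≤ (i + 1).choose 2 := Nat.choose_le_choose 2 hj
      have h8 : ε ^ (i + 1) ≤ ε ^ ((j : ℕ) + 1) := pow_le_pow_of_le_one hε.le hε1 hj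
      have h9 : (2 : ℝ) ^ (((j : ℕ) + 1).choose 2) ≤ 2 ^ ((i + 1).choose 2) :=
        pow_le_pow_right₀ (by norm_num) h7
      gcongr
    set B := 2 * (2 ^ ((i + 1).choose 2) / ε ^ (i + 1)) with hB
    have hsum : ∑ j ∈ Finset.Iio (⟨i + 1, hi⟩ : Fin n), ((i.choose (j : ℕ) : ℕ) : ℝ) = 2 ^ i := by
      have h1 := Finset.sum_map (Finset.Iio (⟨i + 1, hi⟩ : Fin n)) Fin.valEmbedding
        fun j => ((i.choose j : ℕ) : ℝ)
      rw [Fin.map_valEmbedding_Iio] at h1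
      rw [show Finset.Iio ((⟨i + 1, hi⟩ : Fin n) : ℕ) = Finset.range (i + 1) by
        ext; simp] at h1
      refine h1.symm.trans ?_
      exact_mod_cast Nat.sum_range_choose i
    calc |lowerSum x ⟨i + 1, hi⟩|
        ≤ ∑ j ∈ Finset.Iio (⟨i + 1, hi⟩ : Fin n), |((i.choose (j : ℕ) : ℕ) : ℝ) * x j| :=
          Finset.abs_sum_le_sum_abs _ _
      _ < ∑ j ∈ Finset.Iio (⟨i + 1, hi⟩ : Fin n), ((i.choose (j : ℕ) : ℕ) : ℝ) * B := by
          -- Strictness comes from the last index `j = i`, whose weight `i.choose i` is `1`.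
          refine Finset.sum_lt_sum (fun j hj => ?_) ⟨⟨i, by omega⟩, by simp [Fin.lt_def], ?_⟩
          · rw [abs_mul, Nat.abs_cast]
            exact mul_le_mul_of_nonneg_left (hbound j (by simpa [Fin.lt_def] using hj)).le
              (Nat.cast_nonneg _)
          · simpa using hbound ⟨i, by omega⟩ (Nat.lt_succ_self i)
      _ = deformedConst ε (i + 1) := by
          rw [← Finset.sum_mul, hsum, hB, deformedConst, Nat.choose_succ_succ' (i + 1) 1,
            Nat.choose_one_right, pow_add (2 : ℝ), pow_succ (2 : ℝ) i]
          ring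

theorem pos_deformedConst_add_lowerSum {ε : ℝ} (hε : 0 < ε) (hε1 : ε ≤ 1) {x : Fin n → ℝ}
    (i : Fin n)
    (hx : ∀ j < i, |ε * x j| ≤ deformedConst ε j + (-1) ^ (j : ℕ) * lowerSum x j) :
    0 < deformedConst ε i + (-1) ^ (i : ℕ) * lowerSum x i := by
  have h1 := abs_lowerSum_lt hε hε1 i hx
  have h3 : |(-1) ^ (i : ℕ) * lowerSum x i| = |lowerSum x i| := by
    rw [abs_mul, abs_pow, abs_neg, abs_one, one_pow, one_mul]
  have h4 := neg_abs_le ((-1) ^ (i : ℕ) * lowerSum x i)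
  linarith

/-- A vector whose coordinates are determined recursively by the preceding ones. -/
theorem exists_triangular (b a : Fin n → ℝ) :
    ∃ x : Fin n → ℝ, ∀ i, x i = a i * (b i + (-1) ^ (i : ℕ) * lowerSum x i) := by
  let step : ∀ i : Fin n, (∀ j, j < i → ℝ) → ℝ := fun i y =>
    a i * (b i + (-1) ^ (i : ℕ) *
      ∑ j ∈ (Finset.Iio i).attach,
        (((i : ℕ) - 1).choose (j : ℕ) : ℝ) * y j (Finset.mem_Iio.1 j.2))
  refine ⟨wellFounded_lt.fix step, fun i => ?_⟩
  rw [wellFounded_lt.fix_eq]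
  simp only [step, lowerSum]
  rw [Finset.sum_attach (Finset.Iio i)
    (fun j => (((i : ℕ) - 1).choose (j : ℕ) : ℝ) * wellFounded_lt.fix step j)]

theorem isCubeSystem_deformedCube {ε : ℝ} (hε : 0 < ε) (hε1 : ε ≤ 1) :
    IsCubeSystem (deformedFunctional n ε) (deformedBound n ε) (deformedCube n ε) where
  toIsFacetSystem := deformedCube_eq_polyhedron hε ▸ isFacetSystem_polyhedron _ _
  consistent x hx i h1 h2 := by
    have h := pos_deformedConst_add_lowerSum hε hε1 i
      fun j _ => (mem_deformedCube_iff hε).1 hx j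
    simp [tightSet, deformedFunctional_apply, deformedBound] at h1 h2
    linarith
  exists_tightSet_eq T hT := by
    classical
    -- The factors `1`, `-1`, `0` place `x_i` at the upper end, the lower end or the midpoint of its
    -- interval.
    obtain ⟨x, hx⟩ := exists_triangular (n := n) (fun i => deformedConst ε i)
      (fun i => (if (i, true) ∈ T then 1 else if (i, false) ∈ T then -1 else 0) / ε)
    have hx' : ∀ i, ε * x i = (if (i, true) ∈ T then 1 else if (i, false) ∈ T then -1 else 0) *
        (deformedConst ε i + (-1) ^ (i : ℕ) * lowerSum x i) := fun i => by
      rw [hx i]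
      field_simp
    have hmem : ∀ i : Fin n, |ε * x i| ≤ deformedConst ε i + (-1) ^ (i : ℕ) * lowerSum x i := by
      intro i
      induction i using WellFoundedLT.induction with
      | ind i ih =>
      have hpos := pos_deformedConst_add_lowerSum hε hε1 i ih
      rw [hx' i, abs_mul, abs_of_pos hpos]
      refine mul_le_of_le_one_left hpos.le ?_
      split_ifs <;> norm_num
    refine ⟨x, (mem_deformedCube_iff hε).2 hmem, Set.ext fun ⟨i, a⟩ => ?_⟩
    have hpos := pos_deformedConst_add_lowerSum hε hε1 i fun j _ => hmem j
    have hi := hx' i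
    have hTi := hT i
    simp only [tightSet, Set.mem_ofPred_eq, deformedFunctional_apply, deformedBound]
    by_cases h1 : (i, true) ∈ T
    · rw [if_pos h1] at hi
      cases a
      · simp only [hTi h1, iff_false, Bool.false_eq_true, if_false]
        intro h
        linarith
      · simp only [h1, iff_true, if_true]
        linarith
    · by_cases h2 : (i, false) ∈ T
      · rw [if_neg h1, if_pos h2] at hi
        cases a
        · simp only [h2, iff_true, Bool.false_eq_true, if_false]
          linarith
        · simp only [h1, iff_false, if_true]
          intro h
          linarith
      · rw [if_neg h1, if_neg h2] at hi
        cases a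
        · simp only [h2, iff_false, Bool.false_eq_true, if_false]
          intro h
          linarith
        · simp only [h1, iff_false, if_true]
          intro h
          linarith

theorem isCompact_deformedCube {ε : ℝ} (hε : 0 < ε) (hε1 : ε ≤ 1) :
    IsCompact (deformedCube n ε) := by
  have hclosed : IsClosed (deformedCube n ε) :=
    deformedCube_eq_polyhedron (n := n) hε ▸ isClosed_polyhedron _ _
  refine Metric.isCompact_of_isClosed_isBounded hclosed ?_
  refine (Bornology.IsBounded.subset (isCompact_Icc
    (a := fun i : Fin n => -(2 * deformedConst ε i / ε))
    (b := fun i : Fin n => 2 * deformedConst ε i / ε)).isBounded) fun x hx => ?_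
  rw [← Set.pi_univ_Icc]
  rw [mem_deformedCube_iff hε] at hx
  intro i _
  have h1 := abs_lowerSum_lt hε hε1 i fun j _ => hx j
  have h3 : |(-1) ^ (i : ℕ) * lowerSum x i| = |lowerSum x i| := by
    rw [abs_mul, abs_pow, abs_neg, abs_one, one_pow, one_mul]
  have h4 := le_abs_self ((-1) ^ (i : ℕ) * lowerSum x i)
  have h2 := hx i
  rw [abs_mul, abs_of_pos hε] at h2
  refine abs_le.1 ?_
  rw [le_div_iff₀ hε]
  linarith

end DeformedCube

end CubicalPolytopes

namespace CubicalPolytopes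

/-! ### Polynomials with alternating signs. -/

section Alternation

open Polynomial

/-- Among the first `N` numbers, a set missing `μ` of them contains `N - 2 * μ` numbers whose
parities alternate, starting with an even one. -/
theorem exists_alternating_subset (S : Finset ℕ) (N : ℕ) :
    ∃ A ⊆ S, (∀ a ∈ A, a < N) ∧ N ≤ A.card + 2 * (Finset.range N \ S).card ∧
      ∀ a ∈ A, a % 2 = (A.filter (· < a)).card % 2 := by
  induction N with
  | zero => exact ⟨∅, by simp⟩
  | succ N ih =>
    obtain ⟨A, hAS, hAN, hcard, hpar⟩ := ih
    by_cases hN : N ∈ S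
    · have hsd : Finset.range (N + 1) \ S = Finset.range N \ S := by
        rw [Finset.range_add_one, Finset.insert_sdiff_of_mem _ hN]
      rw [hsd]
      by_cases hp : N % 2 = A.card % 2
      · have hNA : N ∉ A := fun h => (hAN N h).false
        refine ⟨insert N A, Finset.insert_subset hN hAS, ?_, ?_, ?_⟩
        · simp only [Finset.mem_insert, forall_eq_or_imp]
          exact ⟨N.lt_succ_self, fun a ha => (hAN a ha).trans N.lt_succ_self⟩
        · rw [Finset.card_insert_of_notMem hNA]
          omega
        · simp only [Finset.mem_insert, forall_eq_or_imp]
          refine ⟨?_, fun a ha => ?_⟩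
          · rw [Finset.filter_insert, if_neg (lt_irrefl N), Finset.filter_true_of_mem hAN, hp]
          · rw [Finset.filter_insert, if_neg (hAN a ha).not_gt, hpar a ha]
      -- A parity mismatch makes the inductive inequality strict, so skipping `N` costs nothing.
      · exact ⟨A, hAS, fun a ha => (hAN a ha).trans N.lt_succ_self, by omega, hpar⟩
    · have hsd : (Finset.range (N + 1) \ S).card = (Finset.range N \ S).card + 1 := by
        rw [Finset.range_add_one, Finset.insert_sdiff_of_notMem _ hN,
          Finset.card_insert_of_notMem (by simp)]
      exact ⟨A, hAS, fun a ha => (hAN a ha).trans N.lt_succ_self, by omega, hpar⟩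

/-- The product has sign `(-1)` to the number of `b > a`, and `(-1)^a` counts the `b < a`. Together
they count all of `A` except `a`, so the sign does not depend on `a`. -/
theorem neg_one_pow_mul_prod_sub_pos (A : Finset ℕ) {a : ℕ} (ha : a ∈ A)
    (hpar : a % 2 = (A.filter (· < a)).card % 2) :
    0 < (-1 : ℝ) ^ (A.card - 1) * ((-1) ^ a * ∏ b ∈ A.erase a, ((a : ℝ) - b)) := by
  have h1 : 0 < ∏ b ∈ A.erase a, ((if a < b then -1 else 1 : ℝ) * ((a : ℝ) - b)) := by
    refine Finset.prod_pos fun b hb => ?_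
    rcases lt_or_gt_of_ne (Finset.ne_of_mem_erase hb).symm with h | h
    · have : (a : ℝ) < b := Nat.cast_lt.2 h
      rw [if_pos h]
      linarith
    · have : (b : ℝ) < a := Nat.cast_lt.2 h
      rw [if_neg h.not_gt]
      linarith
  rw [Finset.prod_mul_distrib, Finset.prod_ite, Finset.prod_const, Finset.prod_const_one,
    mul_one] at h1
  have h2 : ((A.erase a).filter (a < ·)).card + (A.filter (· < a)).card = A.card - 1 := by
    rw [← Finset.card_erase_of_mem ha,
      ← Finset.card_filter_add_card_filter_not (s := A.erase a) (a < ·)]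
    congr 2
    ext b
    simp only [Finset.mem_filter, Finset.mem_erase]
    constructor
    · exact fun h => ⟨⟨h.2.ne, h.1⟩, h.2.not_gt⟩
    · exact fun h => ⟨h.1.2, by omega⟩
  rw [← mul_assoc, ← pow_add]
  rw [neg_one_pow_eq_pow_mod_two] at h1 ⊢
  convert h1 using 3
  omega

/-- A polynomial of degree less than `m` whose values alternate weakly in sign at `m + 1` natural
numbers of alternating parity vanishes. -/
theorem eq_zero_of_alternating {q : ℝ[X]} {A : Finset ℕ} {m : ℕ} (hm : m + 1 ≤ A.card)
    (hq : q.degree < (m : ℕ)) (hpar : ∀ a ∈ A, a % 2 = (A.filter (· < a)).card % 2)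
    (hsign : ∀ a ∈ A, 0 ≤ (-1) ^ a * q.eval (a : ℝ)) : q = 0 := by
  have hinj : Set.InjOn (fun a : ℕ => (a : ℝ)) A := Nat.cast_injective.injOn
  have hqA : q.degree < A.card := hq.trans_le (by exact_mod_cast (by omega : m ≤ A.card))
  -- By Lagrange interpolation the coefficient of degree `A.card - 1`, here zero, is a sum over `A`.
  -- After normalization its terms are all nonnegative, so each value of `q` on `A` vanishes.
  have hsum := Lagrange.coeff_eq_sum hinj hqA
  rw [coeff_eq_zero_of_degree_lt
    (hq.trans_le (by exact_mod_cast (by omega : m ≤ A.card - 1)))] at hsum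
  set w : ℕ → ℝ := fun a => (-1 : ℝ) ^ (A.card - 1) * ((-1) ^ a * ∏ b ∈ A.erase a, ((a : ℝ) - b))
    with hw
  have hwpos : ∀ a ∈ A, 0 < w a := fun a ha => neg_one_pow_mul_prod_sub_pos A ha (hpar a ha)
  have hterm : ∀ a ∈ A, (-1) ^ a * q.eval (a : ℝ) / w a =
      (-1 : ℝ) ^ (A.card - 1) * (q.eval (a : ℝ) / ∏ b ∈ A.erase a, ((a : ℝ) - b)) := by
    intro a ha
    have h0 := (hwpos a ha).ne'
    have h2 : ((-1 : ℝ) ^ (A.card - 1)) * (-1) ^ (A.card - 1) = 1 := by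
      rw [← mul_pow]
      simp
    have h3 : ∏ b ∈ A.erase a, ((a : ℝ) - b) ≠ 0 := fun h => h0 (by simp [hw, h])
    rw [div_eq_iff h0, hw]
    have h4 := div_mul_cancel₀ (q.eval (a : ℝ)) h3
    linear_combination (-(-1) ^ a *
      (q.eval (a : ℝ) / (∏ b ∈ A.erase a, ((a : ℝ) - b)) * ∏ b ∈ A.erase a, ((a : ℝ) - b))) * h2 -
      (-1) ^ a * h4
  have hzero : ∑ a ∈ A, (-1) ^ a * q.eval (a : ℝ) / w a = 0 := by
    rw [Finset.sum_congr rfl hterm, ← Finset.mul_sum, ← hsum, mul_zero]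
  rw [Finset.sum_eq_zero_iff_of_nonneg
    fun a ha => div_nonneg (hsign a ha) (hwpos a ha).le] at hzero
  refine eq_zero_of_degree_lt_of_eval_index_eq_zero A hinj hqA fun a ha => ?_
  have := hzero a ha
  rw [div_eq_zero_iff, or_iff_left (hwpos a ha).ne', mul_eq_zero,
    or_iff_right (pow_ne_zero _ (by norm_num))] at this
  exact this

end Alternation

/-! ### Kernel vectors as polynomials in the binomial basis. -/

section BinomialPolynomial

open Polynomial

variable {n : ℕ}

/-- The polynomial whose coefficients in the binomial basis are the coordinates of `v`. -/
noncomputable def binomialPoly (v : Fin n → ℝ) : ℝ[X] :=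
  ∑ j : Fin n, C (v j / (j : ℕ).factorial) * descPochhammer ℝ j

theorem eval_binomialPoly (v : Fin n → ℝ) (t : ℕ) :
    (binomialPoly v).eval (t : ℝ) = ∑ j : Fin n, (t.choose j : ℝ) * v j := by
  rw [binomialPoly, eval_finsetSum]
  refine Finset.sum_congr rfl fun j _ => ?_
  rw [eval_mul, eval_C, descPochhammer_eval_eq_descFactorial,
    Nat.descFactorial_eq_factorial_mul_choose, Nat.cast_mul]
  field_simp

theorem degree_binomialPoly_lt {v : Fin n → ℝ} {m : ℕ} (hv : ∀ j : Fin n, m ≤ j → v j = 0) :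
    (binomialPoly v).degree < (m : ℕ) := by
  rw [← mem_degreeLT]
  refine Submodule.sum_mem _ fun j _ => ?_
  rw [mem_degreeLT]
  by_cases hj : m ≤ j
  · simp [hv j hj]
  · refine (degree_C_mul_le _ _).trans_lt ?_
    rw [degree_eq_natDegree (monic_descPochhammer ℝ j).ne_zero, descPochhammer_natDegree]
    exact_mod_cast not_le.1 hj
where
  degree_C_mul_le (a : ℝ) (p : ℝ[X]) : (C a * p).degree ≤ p.degree := by
    by_cases ha : a = 0
    · simp [ha]
    · rw [degree_C_mul ha]

/-- Evaluation at `0, 1, 2, …` is a unitriangular system in the coordinates of `v`. -/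
theorem eq_zero_of_binomialPoly_eq_zero {v : Fin n → ℝ} (h : binomialPoly v = 0) : v = 0 := by
  funext i
  induction i using WellFoundedLT.induction with
  | ind i ih =>
  have h1 := eval_binomialPoly v i
  rw [h, eval_zero, Finset.sum_eq_single i] at h1
  · simpa using h1.symm
  · intro j _ hj
    rcases lt_or_gt_of_ne hj with hj | hj
    · simp [ih j hj]
    · rw [Nat.choose_eq_zero_of_lt hj]
      simp
  · simp

theorem lowerSum_eq_eval (v : Fin n → ℝ) {i : Fin n} {t : ℕ} (hi : (i : ℕ) = t + 1) :
    lowerSum v i = (binomialPoly v).eval (t : ℝ) := by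
  rw [eval_binomialPoly, lowerSum, hi, Nat.add_sub_cancel]
  refine Finset.sum_subset (Finset.subset_univ _) fun j _ hj => ?_
  have : (i : ℕ) ≤ j := by simpa using hj
  rw [Nat.choose_eq_zero_of_lt (by omega)]
  simp

end BinomialPolynomial

/-! ### Properties of the facet normals for small `ε`. -/

section SmallEps

variable {n : ℕ}

open Filter Topology

theorem continuous_deformedFunctional (p : Fin n × Bool) :
    Continuous fun z : ℝ × (Fin n → ℝ) => deformedFunctional n z.1 p z.2 := by
  simp only [deformedFunctional_apply, lowerSum]
  obtain ⟨i, a⟩ := p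
  cases a <;> simp only [Bool.false_eq_true, if_false, if_true] <;> fun_prop

theorem isCompact_coordinateSphere (Z : Set (Fin n)) :
    IsCompact {v : Fin n → ℝ | ‖v‖ = 1 ∧ ∀ j ∈ Z, v j = 0} := by
  have : {v : Fin n → ℝ | ‖v‖ = 1 ∧ ∀ j ∈ Z, v j = 0} =
      Metric.sphere 0 1 ∩ ⋂ j ∈ Z, {v | v j = 0} := by
    ext v
    simp
  rw [this]
  exact (isCompact_sphere _ _).inter_right (isClosed_biInter fun j _ =>
    isClosed_eq (continuous_apply j) continuous_const)

/-- If no nonzero `v` supported outside `Z` satisfies the limiting inequalities for `ε = 0`, then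
none does for small `ε`. -/
theorem eventually_exists_pos_deformedFunctional (Z : Set (Fin n)) (S : Finset (Fin n))
    (s : Fin n → Bool)
    (h : ∀ v : Fin n → ℝ, (∀ j ∈ Z, v j = 0) → (∀ i ∈ S, deformedFunctional n 0 (i, s i) v ≤ 0) →
      v = 0) :
    ∀ᶠ ε in 𝓝 (0 : ℝ), ∀ v : Fin n → ℝ, (∀ j ∈ Z, v j = 0) →
      (∀ i ∈ S, deformedFunctional n ε (i, s i) v ≤ 0) → v = 0 := by
  -- The condition is homogeneous in `v`, so it suffices to treat unit vectors; compactness makes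
  -- the pointwise openness in `ε` uniform.
  have hK := (isCompact_coordinateSphere Z).eventually_forall_of_forall_eventually
    (x₀ := (0 : ℝ)) (P := fun ε v => ∃ i ∈ S, 0 < deformedFunctional n ε (i, s i) v) (by
      rintro v ⟨hv1, hv⟩
      obtain ⟨i, hi, hpos⟩ : ∃ i ∈ S, 0 < deformedFunctional n 0 (i, s i) v := by
        by_contra! hneg
        rw [h v hv hneg, norm_zero] at hv1
        exact zero_ne_one hv1
      exact (((continuous_deformedFunctional (i, s i)).tendsto (0, v)).eventually
        (lt_mem_nhds hpos)).mono fun z hz => ⟨i, hi, hz⟩)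
  filter_upwards [hK] with ε hε v hv hneg
  by_contra hne
  have hnorm := norm_pos_iff.2 hne
  obtain ⟨i, hi, hpos⟩ := hε (‖v‖⁻¹ • v)
    ⟨by rw [norm_smul, norm_inv, norm_norm, inv_mul_cancel₀ hnorm.ne'],
      fun j hj => by simp [hv j hj]⟩
  rw [map_smul, smul_eq_mul] at hpos
  exact (mul_nonpos_of_nonneg_of_nonpos (inv_nonneg.2 hnorm.le) (hneg i hi)).not_gt hpos

/-- The equality version of `eventually_exists_pos_deformedFunctional`. -/
theorem eventually_exists_ne_deformedFunctional (Z : Set (Fin n)) (S : Finset (Fin n))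
    (s : Fin n → Bool)
    (h : ∀ v : Fin n → ℝ, (∀ j ∈ Z, v j = 0) → (∀ i ∈ S, deformedFunctional n 0 (i, s i) v = 0) →
      v = 0) :
    ∀ᶠ ε in 𝓝 (0 : ℝ), ∀ v : Fin n → ℝ, (∀ j ∈ Z, v j = 0) →
      (∀ i ∈ S, deformedFunctional n ε (i, s i) v = 0) → v = 0 := by
  have hK := (isCompact_coordinateSphere Z).eventually_forall_of_forall_eventually
    (x₀ := (0 : ℝ)) (P := fun ε v => ∃ i ∈ S, deformedFunctional n ε (i, s i) v ≠ 0) (by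
      rintro v ⟨hv1, hv⟩
      obtain ⟨i, hi, hne⟩ : ∃ i ∈ S, deformedFunctional n 0 (i, s i) v ≠ 0 := by
        by_contra! hzero
        rw [h v hv hzero, norm_zero] at hv1
        exact zero_ne_one hv1
      exact (((continuous_deformedFunctional (i, s i)).tendsto (0, v)).eventually_ne
        hne).mono fun z hz => ⟨i, hi, hz⟩)
  filter_upwards [hK] with ε hε v hv hzero
  by_contra hne
  have hnorm := norm_pos_iff.2 hne
  obtain ⟨i, hi, hne'⟩ := hε (‖v‖⁻¹ • v)
    ⟨by rw [norm_smul, norm_inv, norm_norm, inv_mul_cancel₀ hnorm.ne'],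
      fun j hj => by simp [hv j hj]⟩
  rw [map_smul, hzero i hi, smul_zero] at hne'
  exact hne' rfl

/-- For small `ε`, the facet normals of at least `n - r` pairwise different pairs of facets
positively span the dual of the space of the first `m` coordinates. -/
theorem eventually_positivelySpanning (n : ℕ) {m r : ℕ} (h : m + 2 * r + 2 ≤ n) :
    ∀ᶠ ε in 𝓝 (0 : ℝ), ∀ (S : Finset (Fin n)) (s : Fin n → Bool), n ≤ S.card + r →
      ∀ v : Fin n → ℝ, (∀ j : Fin n, m ≤ j → v j = 0) →
        (∀ i ∈ S, deformedFunctional n ε (i, s i) v ≤ 0) → v = 0 := by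
  rw [eventually_all]
  intro S
  rw [eventually_all]
  intro s
  by_cases hS : n ≤ S.card + r
  swap
  · exact Eventually.of_forall fun ε h' => absurd h' hS
  refine (eventually_exists_pos_deformedFunctional {j | m ≤ j} S s fun v hv hneg => ?_).mono
    fun ε hε _ => hε
  obtain ⟨n, rfl⟩ : ∃ k, n = k + 1 := ⟨n - 1, by omega⟩
  -- The index `0` is discarded, as its functional vanishes at `ε = 0`; the others are shifted to
  -- evaluation points `t = i - 1`.
  let T : Finset ℕ := (Finset.univ.filter fun t : Fin n => t.succ ∈ S).map Fin.valEmbedding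
  have hT : ∀ t ∈ T, ∃ h : t + 1 < n + 1, (⟨t + 1, h⟩ : Fin (n + 1)) ∈ S := by
    intro t ht
    obtain ⟨t, ht', rfl⟩ := Finset.mem_map.1 ht
    exact ⟨by simp, (Finset.mem_filter.1 ht').2⟩
  have hmiss : (Finset.range n \ T).card ≤ r := by
    have h1 : Finset.range n \ T ⊆ (Sᶜ).image fun i : Fin (n + 1) => (i : ℕ) - 1 := by
      intro t ht
      simp only [Finset.mem_sdiff, Finset.mem_range] at ht
      refine Finset.mem_image.2 ⟨⟨t + 1, by omega⟩, ?_, by simp⟩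
      refine Finset.mem_compl.2 fun hmem => ht.2 ?_
      exact Finset.mem_map.2 ⟨⟨t, ht.1⟩, Finset.mem_filter.2 ⟨Finset.mem_univ _, hmem⟩, rfl⟩
    have h2 := (Finset.card_le_card h1).trans Finset.card_image_le
    rw [Finset.card_compl, Fintype.card_fin] at h2
    omega
  obtain ⟨A, hAT, -, hcard, hpar⟩ := exists_alternating_subset T n
  have hzero : -binomialPoly v = 0 := by
    refine eq_zero_of_alternating (m := m) (A := A) (by omega)
      (by rw [Polynomial.degree_neg]; exact degree_binomialPoly_lt hv) hpar fun t ht => ?_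
    obtain ⟨h1, h2⟩ := hT t (hAT ht)
    have h3 := hneg _ h2
    rw [deformedFunctional_apply, lowerSum_eq_eval v (t := t) rfl] at h3
    simp only [neg_zero, ite_self, zero_mul, pow_succ] at h3
    rw [Polynomial.eval_neg]
    linarith
  exact eq_zero_of_binomialPoly_eq_zero (neg_eq_zero.1 hzero)

/-- For small `ε`, any `m` facet normals from different pairs of facets are linearly independent
on the space of the first `m` coordinates. -/
theorem eventually_generic (n m : ℕ) :
    ∀ᶠ ε in 𝓝 (0 : ℝ), 0 < ε → ∀ (S : Finset (Fin n)) (s : Fin n → Bool), S.card = m →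
      ∀ v : Fin n → ℝ, (∀ j : Fin n, m ≤ j → v j = 0) →
        (∀ i ∈ S, deformedFunctional n ε (i, s i) v = 0) → v = 0 := by
  suffices h : ∀ (S : Finset (Fin n)) (s : Fin n → Bool),
      ∀ᶠ ε in 𝓝 (0 : ℝ), 0 < ε → S.card = m →
        ∀ v : Fin n → ℝ, (∀ j : Fin n, m ≤ j → v j = 0) →
          (∀ i ∈ S, deformedFunctional n ε (i, s i) v = 0) → v = 0 by
    filter_upwards [eventually_all.2 fun S => eventually_all.2 fun s => h S s] with ε hε h0 S s
    exact hε S s h0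
  intro S s
  by_cases hS : S.card = m
  swap
  · exact Eventually.of_forall fun ε _ h' => absurd h' hS
  -- The index `0` is useless at `ε = 0`, so the limit alone does not suffice. With `k` the least
  -- index outside `S`, the equations before `k` force `v_j = 0` for `j < k` as long as `ε > 0`;
  -- only the rest is treated by the limit.
  have hex : ∃ k, ∀ h : k < n, (⟨k, h⟩ : Fin n) ∉ S := ⟨n, fun h => absurd h (lt_irrefl n)⟩
  classical
  obtain ⟨k, hk, hmin⟩ : ∃ k, (∀ h : k < n, (⟨k, h⟩ : Fin n) ∉ S) ∧
      ∀ j : Fin n, (j : ℕ) < k → j ∈ S := by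
    refine ⟨Nat.find hex, Nat.find_spec hex, fun j hj => ?_⟩
    have := Nat.find_min hex hj
    push Not at this
    exact this.2
  have hev := eventually_exists_ne_deformedFunctional {j : Fin n | m ≤ j ∨ (j : ℕ) < k} S s ?_
  · filter_upwards [hev] with ε hε h0 _ v hv hzero
    have hvk : ∀ j : Fin n, (j : ℕ) < k → v j = 0 := by
      intro j
      induction j using WellFoundedLT.induction with
      | ind j ih =>
      intro hj
      have h1 := hzero j (hmin j hj)
      have h2 : lowerSum v j = 0 := Finset.sum_eq_zero fun i hi => by
        have hi' := Finset.mem_Iio.1 hi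
        rw [ih i hi' (lt_trans hi' hj), mul_zero]
      rw [deformedFunctional_apply, h2, mul_zero, sub_zero, mul_eq_zero] at h1
      refine h1.resolve_left ?_
      dsimp only
      split_ifs
      exacts [h0.ne', neg_ne_zero.2 h0.ne']
    exact hε v (fun j hj => hj.elim (hv j) (hvk j)) hzero
  · intro v hv hzero
    refine eq_zero_of_binomialPoly_eq_zero ?_
    -- Vanishing of the first `k` coordinates gives the roots `0, …, k - 1`, and each `i > k` in `S`
    -- gives the root `i - 1 ≥ k`. As `k ∉ S`, these are `m` distinct roots for a polynomial of
    -- degree less than `m`.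
    let φ : Fin n → ℕ := fun i => if (i : ℕ) < k then i else i - 1
    have hSk : ∀ i ∈ S, (i : ℕ) ≠ k := fun i hi h => hk (h ▸ i.2) (by
      have : (⟨k, h ▸ i.2⟩ : Fin n) = i := Fin.ext h.symm
      rwa [this])
    refine Polynomial.eq_zero_of_degree_lt_of_eval_index_eq_zero (v := fun i => ((φ i : ℕ) : ℝ)) S
      ?_ (hS ▸ degree_binomialPoly_lt fun j hj => hv j (Or.inl hj)) fun i hi => ?_
    · intro i hi j hj hij
      have h1 := hSk i hi
      have h2 := hSk j hj
      have h3 : φ i = φ j := Nat.cast_injective hij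
      simp only [φ] at h3
      refine Fin.ext ?_
      split_ifs at h3 <;> omega
    · by_cases hik : (i : ℕ) < k
      · simp only [φ, if_pos hik]
        rw [eval_binomialPoly]
        refine Finset.sum_eq_zero fun j _ => ?_
        by_cases hj : (j : ℕ) < k
        · rw [hv j (Or.inr hj), mul_zero]
        · rw [Nat.choose_eq_zero_of_lt (by omega), Nat.cast_zero, zero_mul]
      · simp only [φ, if_neg hik]
        have h1 := hSk i hi
        have h2 := hzero i hi
        rw [deformedFunctional_apply,
          lowerSum_eq_eval v (t := (i : ℕ) - 1) (show (i : ℕ) = _ by omega)] at h2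
        simp only [neg_zero, ite_self, zero_mul, zero_sub, neg_eq_zero, mul_eq_zero] at h2
        exact h2.resolve_left (pow_ne_zero _ (by norm_num))

end SmallEps

end CubicalPolytopes

namespace CubicalPolytopes

/-! ### Projections of cubes and the faces they preserve. -/

section Projection

variable {E E' : Type*} [NormedAddCommGroup E] [NormedSpace ℝ E]
  [NormedAddCommGroup E'] [NormedSpace ℝ E']

theorem image_sep_mem {G : Set E} {F : Set E'} (π : E →ₗ[ℝ] E') (hF : F ⊆ π '' G) :
    π '' {x | x ∈ G ∧ π x ∈ F} = F := by
  ext y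
  constructor
  · rintro ⟨x, ⟨-, hx⟩, rfl⟩
    exact hx
  · intro hy
    obtain ⟨x, hx, rfl⟩ := hF hy
    exact ⟨x, ⟨hx, hy⟩, rfl⟩

theorem injOn_of_vectorSpan {G : Set E} (π : E →ₗ[ℝ] E')
    (hinj : ∀ w ∈ vectorSpan ℝ G, π w = 0 → w = 0) : Set.InjOn π G := fun x hx y hy h =>
  sub_eq_zero.1 (hinj _ (vsub_mem_vectorSpan ℝ hx hy) (by
    rw [map_sub, h, sub_self]))

theorem dimension_image_of_injOn {G : Set E} (π : E →ₗ[ℝ] E')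
    (hinj : ∀ w ∈ vectorSpan ℝ G, π w = 0 → w = 0) : dimension (π '' G) = dimension G := by
  have h1 : vectorSpan ℝ (π '' G) = (vectorSpan ℝ G).map π :=
    (AffineMap.map_vectorSpan π.toAffineMap).symm
  rw [dimension, h1, ← LinearMap.range_domRestrict]
  refine LinearMap.finrank_range_of_inj ((injective_iff_map_eq_zero _).2 fun w hw => ?_)
  exact Subtype.ext (hinj w w.2 hw)

theorem isExposed_sep_mem [FiniteDimensional ℝ E] {G : Set E} {F : Set E'} (π : E →ₗ[ℝ] E')
    (hF : IsExposed ℝ (π '' G) F) : IsExposed ℝ G {x | x ∈ G ∧ π x ∈ F} := by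
  rintro ⟨x, hx, hxF⟩
  obtain ⟨f, rfl⟩ := hF ⟨_, hxF⟩
  refine ⟨f.comp π.toContinuousLinearMap, Set.ext fun y => ?_⟩
  constructor
  · rintro ⟨hy, -, h⟩
    exact ⟨hy, fun z hz => h _ ⟨z, hz, rfl⟩⟩
  · rintro ⟨hy, h⟩
    refine ⟨hy, ⟨y, hy, rfl⟩, ?_⟩
    rintro - ⟨z, hz, rfl⟩
    exact h z hz

/-- A linear map that is injective on the directions of `G` induces an isomorphism of face
posets. -/
theorem nonempty_faceIso_image [FiniteDimensional ℝ E] [FiniteDimensional ℝ E'] {G : Set E} (π : E →ₗ[ℝ] E')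
    (hinj : ∀ w ∈ vectorSpan ℝ G, π w = 0 → w = 0) : Nonempty (Face G ≃o Face (π '' G)) := by
  have hG := injOn_of_vectorSpan π hinj
  -- On `G`, the map `g ∘ π` is the identity up to a translation, so `f ∘ g` orders the points of `π
  -- '' G` as `f` orders those of `G`.
  obtain ⟨g, hg⟩ := LinearMap.exists_leftInverse_of_injective (π.domRestrict (vectorSpan ℝ G))
    (LinearMap.ker_eq_bot'.2 fun w hw => Subtype.ext (hinj w w.2 hw))
  have hρ : ∀ x ∈ G, ∀ y ∈ G, ((g (π x) : E) - g (π y)) = x - y := by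
    intro x hx y hy
    have := LinearMap.congr_fun hg ⟨x - y, vsub_mem_vectorSpan ℝ hx hy⟩
    have h2 := congrArg Subtype.val this
    simpa using h2
  have himage : ∀ F : Set E, IsExposed ℝ G F → IsExposed ℝ (π '' G) (π '' F) := by
    rintro F hF ⟨-, x, hx, rfl⟩
    obtain ⟨f, rfl⟩ := hF ⟨x, hx⟩
    have hle : ∀ y ∈ G, ∀ z ∈ G, f (g (π y)) ≤ f (g (π z)) ↔ f y ≤ f z := by
      intro y hy z hz
      have := congrArg f (hρ y hy z hz)
      rw [map_sub, map_sub] at this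
      constructor <;> intro h <;> linarith
    refine ⟨((f : E →ₗ[ℝ] ℝ).comp ((Submodule.subtype _).comp g)).toContinuousLinearMap,
      Set.ext fun y => ⟨?_, ?_⟩⟩
    · rintro ⟨y, hy, rfl⟩
      refine ⟨⟨y, hy.1, rfl⟩, ?_⟩
      rintro - ⟨z, hz, rfl⟩
      exact (hle z hz y hy.1).2 (hy.2 z hz)
    · rintro ⟨⟨y, hy, rfl⟩, h⟩
      exact ⟨y, ⟨hy, fun z hz => (hle z hz y hy).1 (h _ ⟨z, hz, rfl⟩)⟩, rfl⟩
  exact ⟨{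
    toFun F := ⟨π '' F, himage F F.2⟩
    invFun F := ⟨{x | x ∈ G ∧ π x ∈ (F : Set E')}, isExposed_sep_mem π F.2⟩
    left_inv F := by
      refine Subtype.ext (Set.ext fun x => ⟨?_, fun hx => ⟨F.2.subset hx, x, hx, rfl⟩⟩)
      rintro ⟨hx, y, hy, h⟩
      exact hG (F.2.subset hy) hx h ▸ hy
    right_inv F := Subtype.ext (image_sep_mem π F.2.subset)
    map_rel_iff' {F F'} := hG.image_subset_image_iff F.2.subset F'.2.subset }⟩

/-- Stiemke's lemma: the hypothesis keeps the range of `φ` off the standard simplex. A separating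
functional vanishes on that subspace and is negative on the simplex, so its negated values at the
vertices are the weights. -/
theorem exists_pos_sum_mul_eq_zero {K V : Type*} [Fintype K] [AddCommGroup V] [Module ℝ V]
    (φ : K → V →ₗ[ℝ] ℝ) (h : ∀ v, (∀ k, φ k v ≤ 0) → ∀ k, φ k v = 0) :
    ∃ a : K → ℝ, (∀ k, 0 < a k) ∧ ∀ v, ∑ k, a k * φ k v = 0 := by
  classical
  let W : Submodule ℝ (K → ℝ) := LinearMap.range (LinearMap.pi φ)
  have hdisj : Disjoint (stdSimplex ℝ K) (W : Set (K → ℝ)) := by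
    rw [Set.disjoint_left]
    rintro - hx ⟨v, rfl⟩
    have h0 := h (-v) fun k => by simpa using hx.1 k
    have h1 := hx.2
    simp only [LinearMap.pi_apply] at h1
    rw [Finset.sum_eq_zero fun k _ => by simpa using h0 k] at h1
    exact zero_ne_one h1
  obtain ⟨f, u, t, hu, hut, ht⟩ := geometric_hahn_banach_compact_closed (convex_stdSimplex ℝ K)
    (isCompact_stdSimplex ℝ K) W.convex W.closed_of_finiteDimensional hdisj
  have ht0 : t < 0 := by simpa using ht 0 W.zero_mem
  have hW : ∀ b ∈ W, f b = 0 := by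
    intro b hb
    by_contra hne
    have := ht ((t / f b) • b) (W.smul_mem _ hb)
    rw [map_smul, smul_eq_mul, div_mul_cancel₀ _ hne] at this
    exact this.false
  refine ⟨fun k => -f (Pi.single k 1), fun k => ?_, fun v => ?_⟩
  · have := hu _ (single_mem_stdSimplex ℝ k)
    linarith
  · have h1 := hW _ ⟨v, rfl⟩
    have h2 := LinearMap.pi_apply_eq_sum_univ (f : (K → ℝ) →ₗ[ℝ] ℝ) (LinearMap.pi φ v)
    rw [ContinuousLinearMap.coe_coe, h1] at h2
    have h3 : ∀ k, (Pi.single k 1 : K → ℝ) = fun j => if k = j then 1 else 0 := by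
      intro k
      ext j
      simp [Pi.single_apply, eq_comm]
    simp only [smul_eq_mul, LinearMap.pi_apply] at h2
    rw [← neg_eq_zero, ← Finset.sum_neg_distrib, h2]
    refine Finset.sum_congr rfl fun k _ => ?_
    dsimp only
    rw [h3]
    ring

namespace IsCubeSystem

variable {ι : Type*} [Fintype ι] {l : ι × Bool → E →L[ℝ] ℝ} {c : ι × Bool → ℝ}
  {π : E →ₗ[ℝ] E'} {r : ℕ}

/-- If the facet normals are in general position on the kernel of a projection, then the projection
is injective on the preimages of proper faces. -/
theorem eq_zero_of_mem_vectorSpan_preimage [FiniteDimensional ℝ E]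
    (hι : Module.finrank ℝ (LinearMap.ker π) ≤ Fintype.card ι)
    (hP : IsCubeSystem l c (polyhedron l c))
    (hgen : ∀ (S : Finset ι) (s : ι → Bool), S.card = Module.finrank ℝ (LinearMap.ker π) →
      ∀ v, π v = 0 → (∀ i ∈ S, l (i, s i) v = 0) → v = 0)
    {F : Set E'} (hF : IsExposed ℝ (π '' polyhedron l c) F) (hne : F.Nonempty)
    (hproper : F ≠ π '' polyhedron l c) {w : E}
    (hw : w ∈ vectorSpan ℝ {x | x ∈ polyhedron l c ∧ π x ∈ F}) (hπw : π w = 0) : w = 0 := by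
  have hG := isExposed_sep_mem π hF
  have hGne : {x | x ∈ polyhedron l c ∧ π x ∈ F}.Nonempty := by
    rw [← Set.image_nonempty (f := π), image_sep_mem π hF.subset]
    exact hne
  obtain ⟨x, ⟨hx, hxF⟩, hxG⟩ := hP.exists_eq_faceOn hG hGne
  rw [hxG] at hw
  have hwT : ∀ j ∈ tightSet l c x, l j w = 0 :=
    fun j hj => map_eq_zero_of_mem_vectorSpan_faceOn hw hj
  obtain ⟨S, s, -, hS⟩ := (hP.consistent x hx).exists_finset
  rcases le_total (Module.finrank ℝ (LinearMap.ker π)) S.card with hcard | hcard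
  · obtain ⟨S', hS', hS'card⟩ := Finset.exists_subset_card_eq hcard
    exact hgen S' s hS'card w hπw fun i hi => hwT _ ((hS _ _).2 ⟨hS' hi, rfl⟩)
  · exfalso
    -- With too few tight constraints, their normals extend to a basis of the dual of the kernel.
    -- Any `u` can then be corrected by a kernel vector to be tangent to all tight constraints;
    -- moving both ways shows that `f` vanishes on `π u`, so `F` was not proper.
    obtain ⟨S', hSS', hS'card⟩ := Finset.exists_superset_card_eq hcard hι
    let Φ : LinearMap.ker π →ₗ[ℝ] (S' → ℝ) :=
      LinearMap.pi fun i => (l (i, s i) : E →ₗ[ℝ] ℝ).comp (Submodule.subtype _)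
    have hΦ : Function.Injective Φ := by
      refine (injective_iff_map_eq_zero _).2 fun v hv => Subtype.ext ?_
      exact hgen S' s hS'card v v.2 fun i hi => congrFun hv ⟨i, hi⟩
    have hΦ' : Function.Surjective Φ :=
      (LinearMap.injective_iff_surjective_of_finrank_eq_finrank (by simp [hS'card])).1 hΦ
    obtain ⟨f, rfl⟩ := hF hne
    have hzero : ∀ u, f (π u) = 0 := by
      intro u
      obtain ⟨v, hv⟩ := hΦ' fun i => l (i, s i) u
      have hdir : ∀ w : E, (∀ j ∈ tightSet l c x, l j w = 0) → f (π w) ≤ 0 := by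
        intro w hw
        obtain ⟨δ, hδ, hmem⟩ := exists_add_smul_mem_polyhedron hx hw
        have h1 := hxF.2 _ ⟨_, hmem, rfl⟩
        simp only [map_add, map_smul, smul_eq_mul] at h1
        by_contra! hpos
        have := mul_pos hδ hpos
        linarith
      have hz : ∀ j ∈ tightSet l c x, l j (u - v) = 0 := by
        rintro ⟨i, a⟩ hj
        obtain ⟨hi, rfl⟩ := (hS _ _).1 hj
        rw [map_sub, sub_eq_zero]
        exact (congrFun hv ⟨i, hSS' hi⟩).symm
      have h1 := hdir _ hz
      have h2 := hdir (-(u - v)) fun j hj => by rw [map_neg, hz j hj, neg_zero]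
      have h3 : π v = 0 := v.2
      simp only [map_neg, map_sub, h3, sub_zero] at h1 h2
      linarith
    refine hproper (Set.Subset.antisymm hF.subset ?_)
    rintro - ⟨y, hy, rfl⟩
    refine ⟨⟨y, hy, rfl⟩, ?_⟩
    rintro - ⟨z, hz, rfl⟩
    rw [hzero, hzero]

/-- If the normals of the facets containing a face positively span the dual of the kernel of a
projection, then the projection preserves that face strictly. -/
theorem isExposed_image_faceOn [FiniteDimensional ℝ E'] (hP : IsCubeSystem l c (polyhedron l c))
    (hsurj : Function.Surjective π) {T : Set (ι × Bool)} (hT : IsConsistent T)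
    (hpos : ∀ v, π v = 0 → (∀ j ∈ T, l j v ≤ 0) → v = 0) :
    IsExposed ℝ (π '' polyhedron l c) (π '' faceOn l c (polyhedron l c) T) ∧
      ∀ x ∈ polyhedron l c, π x ∈ π '' faceOn l c (polyhedron l c) T →
        x ∈ faceOn l c (polyhedron l c) T := by
  classical
  obtain ⟨a, ha, hsum⟩ := exists_pos_sum_mul_eq_zero (K := T) (V := LinearMap.ker π)
    (fun j => (l j : E →ₗ[ℝ] ℝ).comp (Submodule.subtype _)) fun v hv j => by
      have : v = 0 := Subtype.ext (hpos v v.2 fun j hj => hv ⟨j, hj⟩)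
      simp [this]
  obtain ⟨ρ, hρ⟩ := LinearMap.exists_rightInverse_of_surjective π (LinearMap.range_eq_top.2 hsurj)
  let f : E →ₗ[ℝ] ℝ := ∑ j : T, a j • (l j : E →ₗ[ℝ] ℝ)
  have hf : ∀ x, f x = ∑ j : T, a j * l j x := fun x => by simp [f]
  -- The positive combination `f` vanishes on the kernel, so it factors through `π`; it therefore
  -- exposes the face both upstairs and in the image.
  have hfρ : ∀ x, f (ρ (π x)) = f x := by
    intro x
    have hker : ρ (π x) - x ∈ LinearMap.ker π := by
      have := LinearMap.congr_fun hρ (π x)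
      simp only [LinearMap.comp_apply, LinearMap.id_apply] at this
      rw [LinearMap.mem_ker, map_sub, this, sub_self]
    have := hsum ⟨_, hker⟩
    rw [← sub_eq_zero, ← map_sub, hf]
    exact this
  have hle : ∀ x ∈ polyhedron l c, f x ≤ ∑ j : T, a j * c j := fun x hx => by
    rw [hf]
    exact Finset.sum_le_sum fun j _ => mul_le_mul_of_nonneg_left (hx j) (ha j).le
  have heq : ∀ x ∈ polyhedron l c, f x = ∑ j : T, a j * c j ↔
      x ∈ faceOn l c (polyhedron l c) T := by
    intro x hx
    rw [hf, Finset.sum_eq_sum_iff_of_le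
      fun (j : T) _ => mul_le_mul_of_nonneg_left (hx j) (ha j).le]
    constructor
    · exact fun h => ⟨hx, fun j hj => mul_left_cancel₀ (ha ⟨j, hj⟩).ne' (h ⟨j, hj⟩ (by simp))⟩
    · rintro ⟨-, h⟩ j -
      have : l j x = c j := h j.2
      rw [this]
  obtain ⟨x₀, hx₀, hx₀T⟩ := hP.exists_tightSet_eq T hT
  have hfx₀ := (heq x₀ hx₀).2 ⟨hx₀, hx₀T.ge⟩
  refine ⟨fun _ => ⟨(f.comp ρ).toContinuousLinearMap, Set.ext fun y => ⟨?_, ?_⟩⟩, ?_⟩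
  · rintro ⟨x, hx, rfl⟩
    refine ⟨⟨x, hx.1, rfl⟩, ?_⟩
    rintro - ⟨z, hz, rfl⟩
    change f (ρ (π z)) ≤ f (ρ (π x))
    rw [hfρ, hfρ, (heq x hx.1).2 hx]
    exact hle z hz
  · rintro ⟨⟨x, hx, rfl⟩, hmax⟩
    have h1 : f (ρ (π x₀)) ≤ f (ρ (π x)) := hmax _ ⟨x₀, hx₀, rfl⟩
    rw [hfρ, hfρ, hfx₀] at h1
    exact ⟨x, (heq x hx).1 (le_antisymm (hle x hx) h1), rfl⟩
  · rintro x hx ⟨z, hz, h⟩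
    refine (heq x hx).1 ?_
    rw [← hfρ x, ← h, hfρ, (heq z hz.1).2 hz]

theorem dimension_image [FiniteDimensional ℝ E] (hP : IsCubeSystem l c (polyhedron l c))
    (hE : Module.finrank ℝ E = Fintype.card ι) (hsurj : Function.Surjective π) :
    dimension (π '' polyhedron l c) = Module.finrank ℝ E' := by
  have h1 : vectorSpan ℝ (polyhedron l c) = ⊤ :=
    Submodule.eq_top_of_finrank_eq ((hP.dimension_eq_card hE).trans hE.symm)
  have h2 : vectorSpan ℝ (π '' polyhedron l c) = (vectorSpan ℝ (polyhedron l c)).map π :=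
    (AffineMap.map_vectorSpan π.toAffineMap).symm
  rw [dimension, h2, h1, Submodule.map_top, LinearMap.range_eq_top.2 hsurj, finrank_top]

theorem isCubicalPolytope_image [FiniteDimensional ℝ E] [FiniteDimensional ℝ E'] (hP : IsCubeSystem l c (polyhedron l c))
    (hc : IsCompact (polyhedron l c)) (hE : Module.finrank ℝ E = Fintype.card ι)
    (hsurj : Function.Surjective π)
    (hgen : ∀ (S : Finset ι) (s : ι → Bool), S.card = Module.finrank ℝ (LinearMap.ker π) →
      ∀ v, π v = 0 → (∀ i ∈ S, l (i, s i) v = 0) → v = 0) :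
    IsCubicalPolytope (Module.finrank ℝ E') (π '' polyhedron l c) := by
  classical
  have himage : ∀ G : Set E, IsPolytope G → IsPolytope (π '' G) := by
    rintro - ⟨s, hs, rfl⟩
    exact ⟨s.image π, hs.image _, by rw [Finset.coe_image, LinearMap.image_convexHull]⟩
  refine ⟨himage _ (hP.isPolytope hc hP.nonempty), hP.dimension_image hE hsurj,
    fun F hF hne hproper => ?_⟩
  have hinj := fun w => hP.eq_zero_of_mem_vectorSpan_preimage (w := w)
    (hE ▸ Submodule.finrank_le _) hgen hF hne hproper
  have hG := isExposed_sep_mem π hF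
  have hGF := image_sep_mem π hF.subset
  have hGne : {x | x ∈ polyhedron l c ∧ π x ∈ F}.Nonempty := by
    rw [← Set.image_nonempty (f := π), hGF]
    exact hne
  obtain ⟨k, hk, ⟨e⟩⟩ := hP.exists_isCombinatorialCube hc hG hGne
  obtain ⟨e'⟩ := nonempty_faceIso_image π hinj
  rw [hGF] at e'
  exact ⟨k, hGF ▸ himage _ hk, ⟨e'.symm.trans e⟩⟩

/-- A face of dimension at most `r` has enough tight constraints for `hpos`. Conversely, a face of
the image of dimension at most `r` is proper by `hr`, so genericity gives its preimage the same
dimension. -/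
theorem inducesSkeletonIso [FiniteDimensional ℝ E] [FiniteDimensional ℝ E'] (hP : IsCubeSystem l c (polyhedron l c))
    (hE : Module.finrank ℝ E = Fintype.card ι) (hsurj : Function.Surjective π)
    (hgen : ∀ (S : Finset ι) (s : ι → Bool), S.card = Module.finrank ℝ (LinearMap.ker π) →
      ∀ v, π v = 0 → (∀ i ∈ S, l (i, s i) v = 0) → v = 0)
    (hpos : ∀ (S : Finset ι) (s : ι → Bool), Fintype.card ι ≤ S.card + r →
      ∀ v, π v = 0 → (∀ i ∈ S, l (i, s i) v ≤ 0) → v = 0)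
    (hr : r < Module.finrank ℝ E') :
    InducesSkeletonIso r π (polyhedron l c) := by
  have key : ∀ F : Set E, IsExposed ℝ (polyhedron l c) F → dimension F ≤ r →
      IsExposed ℝ (π '' polyhedron l c) (π '' F) ∧
        (∀ x ∈ polyhedron l c, π x ∈ π '' F → x ∈ F) ∧
        ∀ w ∈ vectorSpan ℝ F, π w = 0 → w = 0 := by
    intro F hF hdim
    obtain rfl | hne := F.eq_empty_or_nonempty
    · rw [Set.image_empty]
      exact ⟨isExposed_empty, fun x _ h => h.elim, fun w hw _ => by simpa using hw⟩
    obtain ⟨x, hxF, hx⟩ := hP.exists_eq_faceOn hF hne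
    have hT := hP.consistent x (hF.subset hxF)
    obtain ⟨S, s, hScard, hS⟩ := hT.exists_finset
    have hcard := hP.dimension_faceOn_add_ncard hE hT
    rw [← hx, ← hScard] at hcard
    have hposT : ∀ v, π v = 0 → (∀ j ∈ tightSet l c x, l j v ≤ 0) → v = 0 := fun v hv h =>
      hpos S s (by omega) v hv fun i hi => h _ ((hS _ _).2 ⟨hi, rfl⟩)
    have := hP.isExposed_image_faceOn hsurj hT hposT
    rw [← hx] at this
    refine ⟨this.1, this.2, fun w hw hπw => hposT w hπw fun j hj => ?_⟩
    rw [hx] at hw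
    exact (map_eq_zero_of_mem_vectorSpan_faceOn hw hj).le
  have hinv : ∀ F : Set E', IsExposed ℝ (π '' polyhedron l c) F → dimension F ≤ r →
      dimension {x | x ∈ polyhedron l c ∧ π x ∈ F} ≤ r := by
    intro F hF hdim
    obtain rfl | hne := F.eq_empty_or_nonempty
    · simp [dimension_empty]
    have hproper : F ≠ π '' polyhedron l c := by
      rintro rfl
      rw [hP.dimension_image hE hsurj] at hdim
      omega
    rwa [← dimension_image_of_injOn π fun w => hP.eq_zero_of_mem_vectorSpan_preimage (w := w)
      (hE ▸ Submodule.finrank_le _) hgen hF hne hproper, image_sep_mem π hF.subset]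
  refine ⟨⟨{
    toFun F := ⟨π '' F.1, (key F.1 F.2.1 F.2.2).1,
      (dimension_image_of_injOn π (key F.1 F.2.1 F.2.2).2.2).trans_le F.2.2⟩
    invFun F := ⟨{x | x ∈ polyhedron l c ∧ π x ∈ F.1}, isExposed_sep_mem π F.2.1,
      hinv F.1 F.2.1 F.2.2⟩
    left_inv F := Subtype.ext (Set.ext fun x =>
      ⟨fun hx => (key F.1 F.2.1 F.2.2).2.1 x hx.1 hx.2,
        fun hx => ⟨F.2.1.subset hx, x, hx, rfl⟩⟩)
    right_inv F := Subtype.ext (image_sep_mem π F.2.1.subset)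
    map_rel_iff' {F G} := ⟨fun h x hx => (key G.1 G.2.1 G.2.2).2.1 x (F.2.1.subset hx)
      (h ⟨x, hx, rfl⟩), fun h => Set.image_mono h⟩ }, fun F => rfl⟩, ?_⟩
  intro x hx y hy hxy
  obtain ⟨F, hF⟩ := Set.mem_iUnion.1 hx
  obtain ⟨G, hG⟩ := Set.mem_iUnion.1 hy
  have hkey := key G.1 G.2.1 G.2.2
  exact injOn_of_vectorSpan π hkey.2.2
    (hkey.2.1 x (F.2.1.subset hF) (hxy ▸ ⟨y, hG, rfl⟩)) hG hxy

end IsCubeSystem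

end Projection

end CubicalPolytopes

/-! ### Assembly: the coordinate projection, vertex counts and the main theorem. -/

namespace CubicalPolytopes

theorem lastCoordinates_apply {n d : ℕ} (h : d ≤ n) (x : Fin n → ℝ) (i : Fin d) :
    lastCoordinates h x i = x ⟨n - d + i, by omega⟩ := rfl

theorem lastCoordinates_eq_zero_iff {n d : ℕ} (h : d ≤ n) {v : Fin n → ℝ} :
    lastCoordinates h v = 0 ↔ ∀ j : Fin n, n - d ≤ j → v j = 0 := by
  constructor
  · intro hv j hj
    have := congrFun hv ⟨j - (n - d), by omega⟩
    rw [lastCoordinates_apply] at this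
    rwa [show (⟨n - d + (j - (n - d)), by omega⟩ : Fin n) = j from Fin.ext (by simp; omega)]
      at this
  · intro hv
    funext i
    exact hv _ (by simp)

theorem lastCoordinates_surjective {n d : ℕ} (h : d ≤ n) :
    Function.Surjective (lastCoordinates h) :=
  LinearMap.funLeft_surjective_of_injective ℝ ℝ _ fun i j hij => by
    simpa [Fin.ext_iff] using hij

theorem finrank_ker_lastCoordinates {n d : ℕ} (h : d ≤ n) :
    Module.finrank ℝ (LinearMap.ker (lastCoordinates h)) = n - d := by
  have h1 := LinearMap.finrank_range_add_finrank_ker (lastCoordinates h)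
  rw [LinearMap.range_eq_top.2 (lastCoordinates_surjective h), finrank_top] at h1
  simp only [Module.finrank_fin_fun] at h1
  omega

theorem exists_forall_projection {n d r : ℕ} (hdn : d ≤ n) (hr : 2 * r + 2 ≤ d) :
    ∃ ε₀ : ℝ, 0 < ε₀ ∧ ε₀ ≤ 1 ∧ ∀ ε : ℝ, 0 < ε → ε < ε₀ →
      IsCubicalPolytope d (lastCoordinates hdn '' deformedCube n ε) ∧
      InducesSkeletonIso r (lastCoordinates hdn) (deformedCube n ε) := by
  obtain ⟨δ, hδ, hball⟩ := Metric.eventually_nhds_iff.1 ((eventually_generic n (n - d)).and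
    (eventually_positivelySpanning n (m := n - d) (r := r) (by omega)))
  refine ⟨min δ 1, by positivity, min_le_right _ _, fun ε hε hlt => ?_⟩
  obtain ⟨hgen, hpos⟩ := hball (y := ε) (by
    rw [Real.dist_eq, sub_zero, abs_of_pos hε]
    exact hlt.trans_le (min_le_left _ _))
  have hε1 : ε ≤ 1 := hlt.le.trans (min_le_right _ _)
  have hP := isCubeSystem_deformedCube (n := n) hε hε1
  have hc := isCompact_deformedCube (n := n) hε hε1
  rw [deformedCube_eq_polyhedron hε] at hP hc ⊢
  have hE : Module.finrank ℝ (Fin n → ℝ) = Fintype.card (Fin n) := by simp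
  have hsurj := lastCoordinates_surjective hdn
  have hgen' : ∀ (S : Finset (Fin n)) (s : Fin n → Bool),
      S.card = Module.finrank ℝ (LinearMap.ker (lastCoordinates hdn)) →
      ∀ v, lastCoordinates hdn v = 0 →
        (∀ i ∈ S, deformedFunctional n ε (i, s i) v = 0) → v = 0 := fun S s hS v hv =>
    hgen hε S s (hS.trans (finrank_ker_lastCoordinates hdn)) v
      ((lastCoordinates_eq_zero_iff hdn).1 hv)
  constructor
  · simpa using hP.isCubicalPolytope_image hc hE hsurj hgen'
  · refine hP.inducesSkeletonIso hE hsurj hgen' (fun S s hS v hv => ?_) (by simp; omega)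
    exact hpos S s (by simpa using hS) v ((lastCoordinates_eq_zero_iff hdn).1 hv)

theorem nonempty_skeletonIso_standardCube {n : ℕ} {ε : ℝ} (hε : 0 < ε) (hε1 : ε ≤ 1) (k : ℕ) :
    Nonempty (Skeleton k (deformedCube n ε) ≃o Skeleton k (standardCube n)) :=
  (isCubeSystem_deformedCube hε hε1).nonempty_skeletonIso (isCubeSystem_standardCube n)
    (by simp) (by simp) k

/-- Vertices correspond to complete sign choices `s : ι → Bool`, since dimension zero forces one
tight constraint per index. -/
theorem IsCubeSystem.ncard_vertices {E ι : Type*} [NormedAddCommGroup E] [NormedSpace ℝ E]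
    [FiniteDimensional ℝ E] [Fintype ι] {l : ι × Bool → E →L[ℝ] ℝ} {c : ι × Bool → ℝ} {P : Set E}
    (hP : IsCubeSystem l c P) (hE : Module.finrank ℝ E = Fintype.card ι) :
    (vertices P).ncard = 2 ^ Fintype.card ι := by
  classical
  have hcons : ∀ s : ι → Bool, IsConsistent {p : ι × Bool | p.2 = s p.1} := by
    intro s i h1 h2
    simp_all
  choose f hfP hf using fun s => hP.exists_tightSet_eq _ (hcons s)
  have hdim : ∀ s : ι → Bool, dimension (faceOn l c P {p : ι × Bool | p.2 = s p.1}) = 0 := by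
    intro s
    have h1 := hP.dimension_faceOn_add_ncard hE (hcons s)
    have h2 : ({p : ι × Bool | p.2 = s p.1}).ncard = Fintype.card ι := by
      have : {p : ι × Bool | p.2 = s p.1} = Set.range fun i => (i, s i) := by
        ext ⟨i, a⟩
        simp [eq_comm]
      rw [this, Set.ncard_range_of_injective fun i j h => congrArg Prod.fst h,
        Nat.card_eq_fintype_card]
    omega
  have hsing : ∀ s : ι → Bool, faceOn l c P {p : ι × Bool | p.2 = s p.1} = {f s} := by
    intro s
    have h1 := Submodule.finrank_eq_zero.1 (hdim s)
    have h2 : (faceOn l c P {p : ι × Bool | p.2 = s p.1}).Subsingleton :=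
      (vectorSpan_eq_bot_iff_subsingleton ℝ).1 h1
    exact h2.eq_singleton_of_mem ⟨hfP s, (hf s).ge⟩
  have hrange : vertices P = Set.range f := by
    ext v
    constructor
    · intro hv
      obtain ⟨x, rfl, hx⟩ := hP.exists_eq_faceOn hv (Set.singleton_nonempty v)
      have hT := hP.consistent x (hv.subset rfl)
      have h1 := hP.dimension_faceOn_add_ncard hE hT
      rw [← hx] at h1
      obtain ⟨S, s, hS, hSs⟩ := hT.exists_finset
      have h0 := dimension_singleton x
      have huniv : S = Finset.univ := (Finset.card_eq_iff_eq_univ S).1 (by omega)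
      refine ⟨s, ?_⟩
      have h3 : tightSet l c x = {p : ι × Bool | p.2 = s p.1} := by
        ext ⟨i, a⟩
        rw [hSs, huniv]
        simp
      rw [h3, hsing] at hx
      exact (Set.singleton_eq_singleton_iff.1 hx).symm
    · rintro ⟨s, rfl⟩
      change IsExposed ℝ P {f s}
      rw [← hsing]
      exact hP.isExposed_faceOn _
  have hinj : Function.Injective f := by
    intro s t h
    funext i
    have h1 : (i, s i) ∈ tightSet l c (f s) := (hf s).ge rfl
    rw [h, hf t] at h1
    exact h1
  rw [hrange, Set.ncard_range_of_injective hinj, Nat.card_eq_fintype_card, Fintype.card_fun,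
    Fintype.card_bool]

/-- A projection that induces an isomorphism of skeleta preserves the number of vertices. -/
theorem InducesSkeletonIso.ncard_vertices {E E' : Type*} [NormedAddCommGroup E] [NormedSpace ℝ E]
    [NormedAddCommGroup E'] [NormedSpace ℝ E'] {k : ℕ} {π : E →ₗ[ℝ] E'} {P : Set E}
    (h : InducesSkeletonIso k π P) : (vertices (π '' P)).ncard = (vertices P).ncard := by
  obtain ⟨⟨e, he⟩, hinj⟩ := h
  have himage : vertices (π '' P) = π '' vertices P := by
    ext y
    constructor
    · intro hy
      obtain ⟨F, hF⟩ := e.surjective ⟨{y}, hy, (dimension_singleton y).trans_le k.zero_le⟩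
      have hFy : π '' (F : Set E) = {y} := by rw [← he, hF]
      obtain ⟨x, hx, hxy⟩ : y ∈ π '' (F : Set E) := hFy.ge rfl
      refine ⟨x, ?_, hxy⟩
      have : (F : Set E) = {x} := by
        refine Set.eq_singleton_iff_unique_mem.2 ⟨hx, fun z hz => ?_⟩
        refine hinj (Set.mem_iUnion.2 ⟨F, hz⟩) (Set.mem_iUnion.2 ⟨F, hx⟩) ?_
        rw [hxy]
        exact hFy.le ⟨z, hz, rfl⟩
      change IsExposed ℝ P {x}
      exact this ▸ F.2.1
    · rintro ⟨x, hx, rfl⟩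
      let F : Skeleton k P := ⟨{x}, hx, (dimension_singleton x).trans_le k.zero_le⟩
      have h1 : (e F : Set E') = {π x} := by rw [he, Set.image_singleton]
      change IsExposed ℝ (π '' P) {π x}
      exact h1 ▸ (e F).2.1
  rw [himage]
  refine Set.InjOn.ncard_image (hinj.mono fun x hx => ?_)
  exact Set.mem_iUnion.2 ⟨⟨{x}, hx, (dimension_singleton x).trans_le k.zero_le⟩, rfl⟩

end CubicalPolytopes

theorem mainTheorem1 :
    (∀ (n d r : ℕ) (hdn : d ≤ n), 2 * r + 2 ≤ d →
      (∀ ε : ℝ, 0 < ε → ε ≤ 1 → IsCombinatorialCube n (deformedCube n ε)) ∧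
      ∃ ε₀ : ℝ, 0 < ε₀ ∧ ε₀ ≤ 1 ∧ ∀ ε : ℝ, 0 < ε → ε < ε₀ →
        IsCubicalPolytope d (lastCoordinates hdn '' deformedCube n ε) ∧
        InducesSkeletonIso r (lastCoordinates hdn) (deformedCube n ε)) ∧
    (∀ n d : ℕ, 2 ≤ d → d ≤ n →
      ∃ P : Set (Fin d → ℝ), IsNeighborlyCubical n d P) ∧
    (∀ n : ℕ, 5 ≤ n → HasDimensionallyAmbiguousSkeleton 1 (standardCube n)) := by
  refine ⟨fun n d r hdn hr => ⟨fun ε hε hε1 => ?_, exists_forall_projection hdn hr⟩,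
    fun n d hd hdn => ?_, fun n hn => ?_⟩
  · exact (isCubeSystem_deformedCube hε hε1).isCombinatorialCube (isCompact_deformedCube hε hε1)
  · obtain ⟨ε₀, h0, h1, h⟩ := exists_forall_projection (r := d / 2 - 1) hdn (by omega)
    obtain ⟨hcub, hskel⟩ := h (ε₀ / 2) (by linarith) (by linarith)
    obtain ⟨e⟩ := nonempty_skeletonIso_standardCube (n := n) (ε := ε₀ / 2) (by linarith)
      (by linarith) (d / 2 - 1)
    refine ⟨_, hcub, ?_, ?_⟩
    · rw [hskel.ncard_vertices, (isCubeSystem_deformedCube (n := n) (ε := ε₀ / 2) (by linarith)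
        (by linarith)).ncard_vertices (by simp), Fintype.card_fin]
    · obtain ⟨⟨e', -⟩, -⟩ := hskel
      exact ⟨e'.symm.trans e⟩
  -- Dimension `4` is the least `d` allowed for `r = 1`, and `n ≥ 5` makes it differ from `n`.
  · obtain ⟨ε₀, h0, h1, h⟩ := exists_forall_projection (n := n) (d := 4) (r := 1) (by omega)
      (by omega)
    obtain ⟨hcub, ⟨e', -⟩, -⟩ := h (ε₀ / 2) (by linarith) (by linarith)
    obtain ⟨e⟩ := nonempty_skeletonIso_standardCube (n := n) (ε := ε₀ / 2) (by linarith)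
      (by linarith) 1
    refine ⟨4, _, hcub.1, ?_, ⟨e.symm.trans e'⟩⟩
    rw [hcub.2.1, dimension_standardCube]
    omega
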